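/- Let $X=(X_t)_{t\ge 0}$ be a real Lévy process (independent and stationary increments, $X_0=0$ and càdlàg paths almost surely) with generating triplet $(\gamma,b^2,\nu)$, i.e. $\gamma\in\mathbb R$, $b\ge 0$, $\nu$ is a measure on $\mathbb R$ with $\nu(\{0\})=0$ and $\int \min(1,x^2)\,\nu(dx)<\infty$, and $$\mathbb E e^{iuX_t}=\exp\Big\{t\Big(i\gamma u-\frac{b^2u^2}{2}+\int_{\mathbb R}\big(e^{iux}-1-iux\mathbf 1_{|x|\le 1}\big)\nu(dx)\Big)\Big\},\qquad t\ge 0,\ u\in\mathbb R .$$ Let $bB$ be the Brownian component of $X$: if $b>0$, $B$ is a standard Brownian motion such that the processes $B$ and $X-bB$ are independent (if $b=0$, the term $bB$ is zero). For $0<\epsilon\le 1$ and $t\ge 0$ put $$X^\epsilon_t=\gamma t+bB_t+\sum_{0\le s\le t}\Delta X_s\mathbf 1_{\{|\Delta X_s|>\epsilon\}}-t\int_{\epsilon<|x|\le 1}x\,\nu(dx),\qquad R^\epsilon_t=X_t-X^\epsilon_t,$$ where $\Delta X_s=X_s-X_{s-}$ and $\Delta X_0=0$, and $$\sigma(\epsilon)=\Big(\int_{|x|\le\epsilon}x^2\,\nu(dx)\Big)^{1/2},\qquad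 \sigma_0(\epsilon)=\max(\sigma(\epsilon),\epsilon).$$ Then, for all $t\ge 0$ and $0<\epsilon\le 1$, $|R^\epsilon_t|^4$ is integrable and $$\mathbb E|R^\epsilon_t|^4=t\int_{|x|\le\epsilon}x^4\,\nu(dx)+3\big(t\sigma(\epsilon)^2\big)^2 .$$ Moreover, for every real $q>0$ and every $t\ge 0$ there is a constant $K_{q,t}>0$, depending only on $q$ and $t$ (not on $X$, its triplet, or $\epsilon$), such that $|R^\epsilon_t|^q$ is integrable and $$\mathbb E|R^\epsilon_t|^q\le K_{q,t}\,\sigma_0(\epsilon)^q\qquad\text{for all }0<\epsilon\le 1 .$$ -/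

import Mathlib

open MeasureTheory ProbabilityTheory Filter
open scoped NNReal Topology

universe u

namespace SmallJumps

/-- A path `x : [0, ∞) → ℝ` is càdlàg: right-continuous with left limits. -/
def IsCadlag (x : ℝ≥0 → ℝ) : Prop :=
  ∀ t, ContinuousWithinAt x (Set.Ici t) t ∧ ∃ l, Tendsto x (𝓝[<] t) (𝓝 l)

/-- The jump `Δx_s = x_s - x_{s-}` of a path; at `s = 0` Mathlib's left limit is `x 0`,
so `Δx_0 = 0`. -/
noncomputable def jump (x : ℝ≥0 → ℝ) (s : ℝ≥0) : ℝ :=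
  x s - Function.leftLim x s

/-- A real Lévy process: starts from `0`, has independent and stationary increments and, almost
surely, càdlàg paths. -/
structure IsLevyProcess {Ω : Type*} [MeasurableSpace Ω] (P : Measure Ω) (X : ℝ≥0 → Ω → ℝ) :
    Prop where
  measurable : ∀ t, Measurable (X t)
  zero : ∀ᵐ ω ∂P, X 0 ω = 0
  indep : HasIndepIncrements X P
  stationary : ∀ s h : ℝ≥0, IdentDistrib (fun ω => X (s + h) ω - X s ω) (X h) P P
  cadlag : ∀ᵐ ω ∂P, IsCadlag (fun t => X t ω)

/-- A Lévy measure on `ℝ`: no mass at `0` and `∫ min(1, x²) ν(dx) < ∞`. -/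
structure IsLevyMeasure (ν : Measure ℝ) : Prop where
  zero : ν {0} = 0
  integrable : Integrable (fun x : ℝ => min 1 (x ^ 2)) ν

/-- `X` has generating triplet `(γ, b², ν)` (with truncation function `1_{|x| ≤ 1}`): `ν` is a
Lévy measure and the characteristic function of every `X t` is given by the
Lévy–Khintchine formula. -/
structure HasTriplet {Ω : Type*} [MeasurableSpace Ω] (P : Measure Ω) (X : ℝ≥0 → Ω → ℝ)
    (γ b : ℝ) (ν : Measure ℝ) : Prop where
  levyMeasure : IsLevyMeasure ν
  charFun_eq : ∀ (t : ℝ≥0) (u : ℝ),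
    ∫ ω, Complex.exp (Complex.I * u * X t ω) ∂P =
      Complex.exp (t * (Complex.I * γ * u - (b : ℂ) ^ 2 * u ^ 2 / 2 +
        ∫ x : ℝ, (Complex.exp (Complex.I * u * x) - 1 -
          Complex.I * u * Set.indicator {y : ℝ | |y| ≤ 1} (fun y => (y : ℂ)) x) ∂ν))

/-- `b B` is the Brownian component of `X`: `B` is a standard Brownian motion such that `X` is the
independent sum of `b B` and a remaining process. If `b = 0` there is no Brownian component and
`B` is irrelevant. -/
def IsBrownianComponent {Ω : Type*} [MeasurableSpace Ω] (P : Measure Ω) (X : ℝ≥0 → Ω → ℝ)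
    (b : ℝ) (B : ℝ≥0 → Ω → ℝ) : Prop :=
  b ≠ 0 → IsBrownianReal B P ∧
    IndepFun (fun ω (s : ℝ≥0) => B s ω) (fun ω (s : ℝ≥0) => X s ω - b * B s ω) P

/-- The process `X^ε`: drift, Brownian component and the jumps exceeding `ε` in absolute value,
compensated on `ε < |x| ≤ 1`. For a càdlàg path the sum has finitely many terms. -/
noncomputable def truncated {Ω : Type*} (X : ℝ≥0 → Ω → ℝ) (γ b : ℝ) (B : ℝ≥0 → Ω → ℝ)
    (ν : Measure ℝ) (ε : ℝ) (t : ℝ≥0) (ω : Ω) : ℝ :=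
  γ * t + b * B t ω
    + (∑ᶠ s ∈ {s : ℝ≥0 | s ≤ t ∧ ε < |jump (fun r => X r ω) s|}, jump (fun r => X r ω) s)
    - t * ∫ x in {x : ℝ | ε < |x| ∧ |x| ≤ 1}, x ∂ν

/-- The remainder `R^ε = X - X^ε`. -/
noncomputable def remainder {Ω : Type*} (X : ℝ≥0 → Ω → ℝ) (γ b : ℝ) (B : ℝ≥0 → Ω → ℝ)
    (ν : Measure ℝ) (ε : ℝ) (t : ℝ≥0) (ω : Ω) : ℝ :=
  X t ω - truncated X γ b B ν ε t ω

/-- `σ(ε) = (∫_{|x| ≤ ε} x² ν(dx))^{1/2}`. -/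
noncomputable def sigma (ν : Measure ℝ) (ε : ℝ) : ℝ :=
  √(∫ x in {x : ℝ | |x| ≤ ε}, x ^ 2 ∂ν)

/-- `σ₀(ε) = max(σ(ε), ε)`. -/
noncomputable def sigma0 (ν : Measure ℝ) (ε : ℝ) : ℝ :=
  max (sigma ν ε) ε

end SmallJumps

/-!
The Laplace transform of the remainder is computed explicitly, and both claims are read off from it.

Split `[0, t]` into `n` equal pieces. If `g` is bounded, continuous and equal to the identity on
`[-ε, ε]`, then the sum of `y - g y` over the increments `y` of a càdlàg path converges to the sum
of `x - g x` over its large jumps `x`. Hence `∑ g (X_{kt/n} - X_{(k-1)t/n})` converges to `X_t`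
minus that sum, and by independence its Laplace transform is the `n`-th power of
`1 + ∫ (exp (l * g x) - 1) dpₙ`, where `pₙ` is the law of `X_{t/n}`.

The limit of `n ∫ h dpₙ` follows from the Lévy–Khintchine formula alone. Averaged second differences
of the characteristic functions are the Fourier transforms of the measures `n (1 - sin x / x) dpₙ`;
these converge weakly, and the limit carries the Gaussian part as an atom at `0`.

Let `g` tend to the sharp truncation `x 1_{|x| ≤ ε}` and divide by the Laplace transform of the
independent Brownian part: `E exp (l R) = exp (t ∫_{|x| ≤ ε} (exp (l x) - 1 - l x) ν(dx))`. Its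
fourth derivative at `0` is the fourth moment. At `l = ±1 / σ₀(ε)` the exponent is at most `t`,
which bounds every absolute moment of `R / σ₀(ε)` in terms of its order and `t` only.
-/

namespace SmallJumps

section PathJumps

variable {x : ℝ≥0 → ℝ}

theorem IsCadlag.tendsto_leftLim (hx : IsCadlag x) (s : ℝ≥0) :
    Tendsto x (𝓝[<] s) (𝓝 (Function.leftLim x s)) :=
  tendsto_leftLim_of_tendsto (hx s).2

theorem jump_eq_zero_of_eq_bot {s : ℝ≥0} (h : 𝓝[<] s = ⊥) : jump x s = 0 := by
  rw [jump, leftLim_eq_of_eq_bot x h, sub_self]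

theorem jump_zero (x : ℝ≥0 → ℝ) : jump x 0 = 0 :=
  jump_eq_zero_of_eq_bot (by simp)

theorem IsCadlag.eventually_near (hx : IsCadlag x) (s : ℝ≥0) {η : ℝ} (hη : 0 < η) :
    ∀ᶠ u in 𝓝 s, (u < s → |x u - Function.leftLim x s| < η) ∧ (s ≤ u → |x u - x s| < η) := by
  have hleft := Metric.tendsto_nhds.1 (hx.tendsto_leftLim s) η hη
  have hright := Metric.tendsto_nhds.1 (hx s).1 η hη
  rw [eventually_nhdsWithin_iff] at hleft hright
  exact hleft.and hright

theorem IsCadlag.abs_jump_le_of_eventually (hx : IsCadlag x) {r : ℝ≥0} {a η : ℝ}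
    (hr : |x r - a| ≤ η) (hleft : ∀ᶠ u in 𝓝[<] r, |x u - a| ≤ η) : |jump x r| ≤ 2 * η := by
  rcases eq_or_neBot (𝓝[<] r) with hbot | hne
  · rw [jump_eq_zero_of_eq_bot hbot, abs_zero]
    linarith [(abs_nonneg _).trans hr]
  · have hlim : |Function.leftLim x r - a| ≤ η :=
      le_of_tendsto ((hx.tendsto_leftLim r).sub_const a).abs hleft
    calc |jump x r| = |(x r - a) - (Function.leftLim x r - a)| := by
          rw [jump, sub_sub_sub_cancel_right]
      _ ≤ |x r - a| + |Function.leftLim x r - a| := abs_sub _ _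
      _ ≤ 2 * η := by linarith

theorem IsCadlag.eventually_abs_jump_le (hx : IsCadlag x) (s : ℝ≥0) {η : ℝ}
    (hη : 0 < η) : ∀ᶠ r in 𝓝[≠] s, |jump x r| ≤ η := by
  rw [eventually_nhdsWithin_iff]
  filter_upwards [eventually_eventually_nhds.2 (hx.eventually_near s (half_pos hη))]
    with r hnear (hrs : r ≠ s)
  rw [← mul_div_cancel₀ η two_ne_zero]
  rcases hrs.lt_or_gt with hlt | hgt
  · refine hx.abs_jump_le_of_eventually (hnear.self_of_nhds.1 hlt).le ?_
    filter_upwards [nhdsWithin_le_nhds hnear, self_mem_nhdsWithin] with u hu hur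
    exact (hu.1 (lt_trans hur hlt)).le
  · refine hx.abs_jump_le_of_eventually (hnear.self_of_nhds.2 hgt.le).le ?_
    filter_upwards [nhdsWithin_le_nhds hnear, nhdsWithin_le_nhds (Ioi_mem_nhds hgt)] with u hu hsu
    exact (hu.2 (le_of_lt hsu)).le

/-- The times up to `t` at which `x` jumps by more than `ε` in absolute value. -/
def largeJumpTimes (x : ℝ≥0 → ℝ) (ε : ℝ) (t : ℝ≥0) : Set ℝ≥0 :=
  {s | s ≤ t ∧ ε < |jump x s|}

/-- The sum of `f (Δx_s)` over the jumps of `x` up to time `t` that exceed `ε` in absolute value;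
it is the sum in `truncated` when `f` is the identity. -/
noncomputable def largeJumpSum (f : ℝ → ℝ) (x : ℝ≥0 → ℝ) (ε : ℝ) (t : ℝ≥0) : ℝ :=
  ∑ᶠ s ∈ largeJumpTimes x ε t, f (jump x s)

theorem IsCadlag.finite_largeJumpTimes (hx : IsCadlag x) (t : ℝ≥0) {η : ℝ}
    (hη : 0 < η) : (largeJumpTimes x η t).Finite := by
  by_contra hinf
  obtain ⟨s, -, hs⟩ := Set.Infinite.exists_accPt_of_subset_isCompact hinf
    (isCompact_Icc (a := 0) (b := t)) fun r hr => ⟨zero_le, hr.1⟩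
  obtain ⟨r, hr, hle⟩ :=
    ((accPt_iff_frequently_nhdsNE.1 hs).and_eventually (hx.eventually_abs_jump_le s hη)).exists
  exact hle.not_gt hr.2

theorem pos_of_mem_largeJumpTimes {t s : ℝ≥0} {η : ℝ} (hη : 0 ≤ η)
    (hs : s ∈ largeJumpTimes x η t) : 0 < s := by
  refine pos_iff_ne_zero.2 fun h => hη.not_gt ?_
  simpa only [h, jump_zero, abs_zero] using hs.2

theorem largeJumpSum_zero_time (f : ℝ → ℝ) (x : ℝ≥0 → ℝ) {ε : ℝ} (hε : 0 ≤ ε) :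
    largeJumpSum f x ε 0 = 0 := by
  have hempty : largeJumpTimes x ε 0 = ∅ :=
    Set.eq_empty_of_forall_notMem fun s hs => hs.1.not_gt (pos_of_mem_largeJumpTimes hε hs)
  rw [largeJumpSum, hempty, finsum_mem_empty]

theorem largeJumpSum_congr_threshold {f : ℝ → ℝ} (x : ℝ≥0 → ℝ) {η ε : ℝ} (hηε : η ≤ ε)
    (hf0 : ∀ y, |y| ≤ ε → f y = 0) (t : ℝ≥0) : largeJumpSum f x η t = largeJumpSum f x ε t := by
  refine finsum_mem_inter_support_eq' _ _ _ fun s hs => ⟨fun h => ⟨h.1, ?_⟩, fun h => ⟨h.1, ?_⟩⟩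
  · exact not_le.1 fun hle => hs (hf0 _ hle)
  · exact hηε.trans_lt h.2

theorem IsCadlag.exists_small_oscillation (hx : IsCadlag x) (t : ℝ≥0) {η : ℝ}
    (hη : 0 < η) :
    ∃ δ > 0, ∀ u v : ℝ≥0, u ≤ v → v ≤ t → dist v u < δ →
      (∀ s, u < s → s ≤ v → |jump x s| ≤ η) → |x v - x u| ≤ 2 * η := by
  choose U hU hUo hsU using fun s => eventually_nhds_iff.1 (hx.eventually_near s (half_pos hη))
  obtain ⟨δ, hδ, hball⟩ := lebesgue_number_lemma_of_metric
    (isCompact_Icc (a := (0 : ℝ≥0)) (b := t)) hUo (fun s _ => Set.mem_iUnion.2 ⟨s, hsU s⟩)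
  refine ⟨δ, hδ, fun u v huv hvt hdist hjump => ?_⟩
  obtain ⟨s, hs⟩ := hball u ⟨zero_le, huv.trans hvt⟩
  have hu := hU s u (hs (Metric.mem_ball_self hδ))
  have hv := hU s v (hs hdist)
  rcases le_or_gt s u with hsu | hus
  · linarith [abs_sub_le (x v) (x s) (x u), abs_sub_comm (x s) (x u), hu.2 hsu,
      hv.2 (hsu.trans huv)]
  rcases le_or_gt s v with hsv | hvs
  · linarith [abs_sub_le (x v) (x s) (x u), abs_sub_le (x s) (Function.leftLim x s) (x u),
      abs_sub_comm (Function.leftLim x s) (x u), hu.1 hus, hv.2 hsv, hjump s hus hsv,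
      show |x s - Function.leftLim x s| = |jump x s| from rfl]
  · linarith [abs_sub_le (x v) (Function.leftLim x s) (x u),
      abs_sub_comm (Function.leftLim x s) (x u), hu.1 hus, hv.1 hvs]

end PathJumps

section Grid

variable {x : ℝ≥0 → ℝ}

/-- The `k`-th point of the partition of `[0, t]` into `n` intervals of equal length. -/
noncomputable def gridPoint (t : ℝ≥0) (n k : ℕ) : ℝ≥0 := t * k / n

/-- The index `k` of the interval `(t k / n, t (k + 1) / n]` that contains `s`. -/
noncomputable def gridIndex (t : ℝ≥0) (n : ℕ) (s : ℝ≥0) : ℕ := ⌈n * s / t⌉₊ - 1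

/-- The increment of `x` over the `k`-th interval of the partition of `[0, t]` into `n` parts. -/
noncomputable def gridIncrement (x : ℝ≥0 → ℝ) (t : ℝ≥0) (n k : ℕ) : ℝ :=
  x (gridPoint t n (k + 1)) - x (gridPoint t n k)

/-- The sum of `f` over the increments of `x` along the partition of `[0, t]` into `n` parts. -/
noncomputable def gridSum (f : ℝ → ℝ) (x : ℝ≥0 → ℝ) (t : ℝ≥0) (n : ℕ) : ℝ :=
  ∑ k ∈ Finset.range n, f (gridIncrement x t n k)

theorem gridPoint_mono (t : ℝ≥0) (n : ℕ) : Monotone (gridPoint t n) := by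
  intro i j hij
  unfold gridPoint
  gcongr

theorem gridPoint_succ (t : ℝ≥0) (n k : ℕ) : gridPoint t n (k + 1) = gridPoint t n k + t / n := by
  rw [gridPoint, gridPoint, Nat.cast_succ, mul_add, add_div, mul_one]

theorem gridPoint_zero (t : ℝ≥0) (n : ℕ) : gridPoint t n 0 = 0 := by
  rw [gridPoint, Nat.cast_zero, mul_zero, zero_div]

theorem gridPoint_self (t : ℝ≥0) {n : ℕ} (hn : n ≠ 0) : gridPoint t n n = t :=
  mul_div_cancel_right₀ t (Nat.cast_ne_zero.2 hn)

theorem gridPoint_le (t : ℝ≥0) {n k : ℕ} (hk : k ≤ n) : gridPoint t n k ≤ t := by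
  rcases eq_or_ne n 0 with rfl | hn
  · simp [gridPoint]
  · exact (gridPoint_mono t n hk).trans (gridPoint_self t hn).le

theorem gridPoint_lt_iff {t : ℝ≥0} (ht : 0 < t) {n : ℕ} (hn : n ≠ 0) {k : ℕ} {s : ℝ≥0} :
    gridPoint t n k < s ↔ k < ⌈n * s / t⌉₊ := by
  have hn' : (0 : ℝ≥0) < n := by positivity
  rw [Nat.lt_ceil, gridPoint, div_lt_iff₀ hn', lt_div_iff₀ ht, mul_comm t, mul_comm s]

theorem gridPoint_gridIndex_lt {t s : ℝ≥0} (ht : 0 < t) {n : ℕ} (hn : n ≠ 0) (hs : 0 < s) :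
    gridPoint t n (gridIndex t n s) < s := by
  rw [gridPoint_lt_iff ht hn, gridIndex]
  exact Nat.sub_lt (Nat.ceil_pos.2 (by positivity)) one_pos

theorem le_gridPoint_gridIndex_succ {t : ℝ≥0} (ht : 0 < t) {n : ℕ} (hn : n ≠ 0) (s : ℝ≥0) :
    s ≤ gridPoint t n (gridIndex t n s + 1) := by
  rw [← not_lt, gridPoint_lt_iff ht hn, gridIndex]
  omega

theorem gridIndex_eq {t s : ℝ≥0} (ht : 0 < t) {n k : ℕ} (hn : n ≠ 0)
    (hlt : gridPoint t n k < s) (hle : s ≤ gridPoint t n (k + 1)) : gridIndex t n s = k := by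
  rw [gridPoint_lt_iff ht hn] at hlt
  rw [← not_lt, gridPoint_lt_iff ht hn] at hle
  rw [gridIndex]
  omega

theorem gridIndex_lt {t s : ℝ≥0} (ht : 0 < t) {n : ℕ} (hn : n ≠ 0) (hs : 0 < s) (hst : s ≤ t) :
    gridIndex t n s < n := by
  refine (gridPoint_mono t n).reflect_lt ?_
  rw [gridPoint_self t hn]
  exact (gridPoint_gridIndex_lt ht hn hs).trans_le hst

theorem tendsto_gridPoint_gridIndex {t s : ℝ≥0} (ht : 0 < t) (hs : 0 < s) :
    Tendsto (fun n => gridPoint t n (gridIndex t n s)) atTop (𝓝[<] s) := by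
  have hlt : ∀ᶠ n in atTop, gridPoint t n (gridIndex t n s) < s := by
    filter_upwards [eventually_ne_atTop 0] with n hn using gridPoint_gridIndex_lt ht hn hs
  have hge : ∀ᶠ n : ℕ in atTop, s - t / n ≤ gridPoint t n (gridIndex t n s) := by
    filter_upwards [eventually_ne_atTop 0] with n hn
    exact tsub_le_iff_right.2 (gridPoint_succ t n _ ▸ le_gridPoint_gridIndex_succ ht hn s)
  have hmesh : Tendsto (fun n : ℕ => s - t / n) atTop (𝓝 s) := by
    simpa only [tsub_zero] using tendsto_const_nhds.sub (tendsto_const_div_atTop_nhds_zero_nat t)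
  exact tendsto_nhdsWithin_iff.2 ⟨tendsto_of_tendsto_of_tendsto_of_le_of_le' hmesh
    tendsto_const_nhds hge (hlt.mono fun _ => le_of_lt), hlt⟩

theorem tendsto_gridPoint_gridIndex_succ {t s : ℝ≥0} (ht : 0 < t) (hs : 0 < s) :
    Tendsto (fun n => gridPoint t n (gridIndex t n s + 1)) atTop (𝓝[≥] s) := by
  refine tendsto_nhdsWithin_iff.2 ⟨?_, ?_⟩
  · simp_rw [gridPoint_succ]
    simpa only [add_zero] using ((tendsto_gridPoint_gridIndex ht hs).mono_right
      nhdsWithin_le_nhds).add (tendsto_const_div_atTop_nhds_zero_nat t)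
  · filter_upwards [eventually_ne_atTop 0] with n hn using le_gridPoint_gridIndex_succ ht hn s

theorem eventually_gridIndex_lt_gridIndex {t s r : ℝ≥0} (ht : 0 < t) (hs : 0 < s) (hsr : s < r) :
    ∀ᶠ n in atTop, gridIndex t n s < gridIndex t n r := by
  filter_upwards [((tendsto_gridPoint_gridIndex ht (hs.trans hsr)).mono_right
    nhdsWithin_le_nhds).eventually (lt_mem_nhds hsr),
    (tendsto_gridPoint_gridIndex ht hs).eventually self_mem_nhdsWithin] with n hr hs
  exact (gridPoint_mono t n).reflect_lt (lt_trans hs hr)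

theorem eventually_injOn_gridIndex {t : ℝ≥0} (ht : 0 < t) {J : Set ℝ≥0} (hJ : J.Finite)
    (hpos : ∀ s ∈ J, 0 < s) : ∀ᶠ n in atTop, Set.InjOn (gridIndex t n) J := by
  have hsep : ∀ s ∈ J, ∀ r ∈ J, ∀ᶠ n in atTop, s < r → gridIndex t n s < gridIndex t n r := by
    intro s hs r _
    by_cases hsr : s < r
    · simpa only [hsr, forall_const] using eventually_gridIndex_lt_gridIndex ht (hpos s hs) hsr
    · exact Eventually.of_forall fun _ h => absurd h hsr
  filter_upwards [hJ.eventually_all.2 fun s hs => hJ.eventually_all.2 (hsep s hs)] with n hn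
  exact StrictMonoOn.injOn fun s hs r hr hsr => hn s hs r hr hsr

theorem gridSum_zero_time {f : ℝ → ℝ} (hf0 : f 0 = 0) (x : ℝ≥0 → ℝ) (n : ℕ) :
    gridSum f x 0 n = 0 := by
  refine Finset.sum_eq_zero fun k _ => ?_
  simp only [gridIncrement, gridPoint, zero_mul, zero_div, sub_self, hf0]

theorem gridSum_id (x : ℝ≥0 → ℝ) (t : ℝ≥0) {n : ℕ} (hn : n ≠ 0) :
    gridSum (fun y => y) x t n = x t - x 0 := by
  calc gridSum (fun y => y) x t n = x (gridPoint t n n) - x (gridPoint t n 0) :=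
        Finset.sum_range_sub (fun k => x (gridPoint t n k)) n
    _ = x t - x 0 := by rw [gridPoint_self t hn, gridPoint_zero]

theorem IsCadlag.tendsto_gridIncrement_gridIndex (hx : IsCadlag x) {t s : ℝ≥0}
    (ht : 0 < t) (hs : 0 < s) :
    Tendsto (fun n => gridIncrement x t n (gridIndex t n s)) atTop (𝓝 (jump x s)) :=
  ((hx s).1.tendsto.comp (tendsto_gridPoint_gridIndex_succ ht hs)).sub
    ((hx.tendsto_leftLim s).comp (tendsto_gridPoint_gridIndex ht hs))

theorem IsCadlag.eventually_abs_gridIncrement_le (hx : IsCadlag x) (t : ℝ≥0) {η : ℝ}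
    (hη : 0 < η) :
    ∀ᶠ n in atTop, ∀ k < n, (∀ s, gridPoint t n k < s → s ≤ gridPoint t n (k + 1) →
      |jump x s| ≤ η) → |gridIncrement x t n k| ≤ 2 * η := by
  obtain ⟨δ, hδ, hosc⟩ := hx.exists_small_oscillation t hη
  filter_upwards [Metric.tendsto_nhds.1 (tendsto_const_div_atTop_nhds_zero_nat t) δ hδ]
    with n hmesh k hk hjump
  refine hosc _ _ (gridPoint_mono t n k.le_succ) (gridPoint_le t hk) ?_ hjump
  rw [NNReal.dist_eq, NNReal.coe_zero, sub_zero] at hmesh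
  rwa [NNReal.dist_eq, gridPoint_succ, NNReal.coe_add, add_sub_cancel_left]

theorem IsCadlag.eventually_gridSum_eq (hx : IsCadlag x) {t : ℝ≥0} (ht : 0 < t)
    {f : ℝ → ℝ} {η : ℝ} (hη : 0 < η) (hf0 : ∀ y, |y| ≤ 2 * η → f y = 0) :
    ∀ᶠ n in atTop, gridSum f x t n = ∑ s ∈ (hx.finite_largeJumpTimes t hη).toFinset,
      f (gridIncrement x t n (gridIndex t n s)) := by
  have hpos : ∀ s ∈ largeJumpTimes x η t, 0 < s := fun s => pos_of_mem_largeJumpTimes hη.le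
  filter_upwards [eventually_injOn_gridIndex ht (hx.finite_largeJumpTimes t hη) hpos,
    eventually_ne_atTop 0, hx.eventually_abs_gridIncrement_le t hη] with n hinj hn hsmall
  rw [← Finset.sum_image (g := gridIndex t n) (f := fun k => f (gridIncrement x t n k))
    (by rwa [Set.Finite.coe_toFinset])]
  refine (Finset.sum_subset ?_ fun k hk hnot => hf0 _ ?_).symm
  · intro k hk
    obtain ⟨s, hs, rfl⟩ := Finset.mem_image.1 hk
    rw [Set.Finite.mem_toFinset] at hs
    exact Finset.mem_range.2 (gridIndex_lt ht hn (hpos s hs) hs.1)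
  · have hkn := Finset.mem_range.1 hk
    refine hsmall k hkn fun s hlt hle => not_lt.1 fun hjump => hnot ?_
    refine Finset.mem_image.2 ⟨s, ?_, gridIndex_eq ht hn hlt hle⟩
    exact (Set.Finite.mem_toFinset _).2 ⟨hle.trans (gridPoint_le t hkn), hjump⟩

theorem IsCadlag.tendsto_gridSum (hx : IsCadlag x) (t : ℝ≥0) {ε : ℝ} (hε : 0 < ε)
    {f : ℝ → ℝ} (hf : Continuous f) (hf0 : ∀ y, |y| ≤ ε → f y = 0) :
    Tendsto (gridSum f x t) atTop (𝓝 (largeJumpSum f x ε t)) := by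
  rcases eq_zero_or_pos t with rfl | ht
  · have hzero : gridSum f x 0 = 0 :=
      funext (gridSum_zero_time (hf0 0 (abs_zero.trans_le hε.le)) x)
    rw [largeJumpSum_zero_time f x hε.le, hzero]
    exact tendsto_const_nhds
  -- Jumps down to `ε / 2` are tracked so that the other increments are at most `ε`.
  · rw [← largeJumpSum_congr_threshold x (half_le_self hε.le) hf0, largeJumpSum,
      finsum_mem_eq_finite_toFinset_sum _ (hx.finite_largeJumpTimes t (half_pos hε))]
    have hincr : ∀ s ∈ (hx.finite_largeJumpTimes t (half_pos hε)).toFinset,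
        Tendsto (fun n => f (gridIncrement x t n (gridIndex t n s))) atTop (𝓝 (f (jump x s))) := by
      intro s hs
      rw [Set.Finite.mem_toFinset] at hs
      exact (hf.tendsto _).comp
        (hx.tendsto_gridIncrement_gridIndex ht (pos_of_mem_largeJumpTimes (half_pos hε).le hs))
    refine (tendsto_finsetSum _ hincr).congr' (EventuallyEq.symm ?_)
    exact hx.eventually_gridSum_eq ht (half_pos hε) (by rwa [mul_div_cancel₀ ε two_ne_zero])

end Grid

section LevyContinuity

variable {E : Type*} [NormedAddCommGroup E] [InnerProductSpace ℝ E] [MeasurableSpace E]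

theorem charFun_normalize {M : FiniteMeasure E} (hM : M ≠ 0) (u : E) :
    charFun (M.normalize : Measure E) u = (M.mass : ℝ)⁻¹ • charFun (M : Measure E) u := by
  rw [M.toMeasure_normalize_eq_of_nonzero hM, charFun_apply, charFun_apply,
    integral_smul_nnreal_measure]
  rfl

variable [FiniteDimensional ℝ E] [BorelSpace E]

theorem finiteMeasure_tendsto_of_tendsto_charFun {M : ℕ → FiniteMeasure E} {M₀ : FiniteMeasure E}
    (h : ∀ u : E, Tendsto (fun n => charFun (M n : Measure E) u) atTop (𝓝 (charFun M₀ u))) :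
    Tendsto M atTop (𝓝 M₀) := by
  have hmass_real : Tendsto (fun n => ((M n).mass : ℝ)) atTop (𝓝 M₀.mass) := by
    have hzero := h 0
    simp only [charFun_zero] at hzero
    exact (Complex.continuous_re.tendsto _).comp hzero
  have hmass : Tendsto (fun n => (M n).mass) atTop (𝓝 M₀.mass) := NNReal.tendsto_coe.1 hmass_real
  rcases eq_or_ne M₀ 0 with rfl | hM₀
  · exact FiniteMeasure.tendsto_zero_of_tendsto_zero_mass hmass
  have hmass₀ : M₀.mass ≠ 0 := (FiniteMeasure.mass_nonzero_iff _).2 hM₀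
  refine FiniteMeasure.tendsto_of_tendsto_normalize_testAgainstNN_of_tendsto_mass
    (ProbabilityMeasure.tendsto_of_tendsto_charFun fun u => ?_) hmass
  rw [charFun_normalize hM₀]
  refine ((hmass_real.inv₀ (NNReal.coe_ne_zero.2 hmass₀)).smul (h u)).congr' ?_
  filter_upwards [hmass.eventually_ne hmass₀] with n hn
  exact (charFun_normalize ((FiniteMeasure.mass_nonzero_iff _).1 hn) u).symm

theorem tendsto_integral_of_tendsto_charFun {m : ℕ → Measure E} {m₀ : Measure E}
    [∀ n, IsFiniteMeasure (m n)] [IsFiniteMeasure m₀]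
    (h : ∀ u, Tendsto (fun n => charFun (m n) u) atTop (𝓝 (charFun m₀ u)))
    {H : E → ℝ} (hH : Continuous H) {C : ℝ} (hC : ∀ x, |H x| ≤ C) :
    Tendsto (fun n => ∫ x, H x ∂(m n)) atTop (𝓝 (∫ x, H x ∂m₀)) :=
  FiniteMeasure.tendsto_iff_forall_integral_tendsto.1
    (finiteMeasure_tendsto_of_tendsto_charFun (M := fun n => ⟨m n, inferInstance⟩)
      (M₀ := ⟨m₀, inferInstance⟩) h)
    (BoundedContinuousFunction.ofNormedAddCommGroup H hH C hC)

end LevyContinuity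

theorem measurableSet_abs_le (ε : ℝ) : MeasurableSet {y : ℝ | |y| ≤ ε} :=
  (isClosed_le continuous_abs continuous_const).measurableSet

theorem min_one_sq_nonneg (x : ℝ) : 0 ≤ min 1 (x ^ 2) := le_min zero_le_one (sq_nonneg x)

theorem integrable_min_one_sq (μ : Measure ℝ) [IsFiniteMeasure μ] :
    Integrable (fun x : ℝ => min 1 (x ^ 2)) μ := by
  refine (integrable_const (1 : ℝ)).mono' (by fun_prop) (Eventually.of_forall fun x => ?_)
  rw [Real.norm_of_nonneg (min_one_sq_nonneg x)]
  exact min_le_left _ _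

theorem IsLevyMeasure.sigmaFinite {ν : Measure ℝ} (hν : IsLevyMeasure ν) : SigmaFinite ν := by
  have hlt : ∀ n : ℕ, ν {x | (1 : ℝ) / (n + 1) ≤ min 1 (x ^ 2)} < ⊤ := fun n => by
    refine lt_of_le_of_lt (measure_mono fun x hx => ?_)
      (hν.integrable.measure_norm_ge_lt_top (ε := 1 / (n + 1)) (by positivity))
    exact (Set.mem_ofPred.1 hx).trans (le_abs_self _)
  refine ⟨⟨⟨fun n => {0} ∪ {x | (1 : ℝ) / (n + 1) ≤ min 1 (x ^ 2)}, fun _ => trivial,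
    fun n => (measure_union_le _ _).trans_lt (by rw [hν.zero, zero_add]; exact hlt n), ?_⟩⟩⟩
  refine Set.eq_univ_of_forall fun x => Set.mem_iUnion.2 ?_
  rcases eq_or_ne x 0 with hx | hx
  · exact ⟨0, Or.inl hx⟩
  · obtain ⟨n, hn⟩ := exists_nat_one_div_lt (lt_min one_pos (by positivity : 0 < x ^ 2))
    exact ⟨n, Or.inr hn.le⟩

theorem norm_exp_ofReal_mul_ofReal_mul_I (u x : ℝ) : ‖Complex.exp (u * x * Complex.I)‖ = 1 := by
  rw [← Complex.ofReal_mul, Complex.norm_exp_ofReal_mul_I]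

theorem integrable_exp_mul_I (μ : Measure ℝ) [IsFiniteMeasure μ] (u : ℝ) :
    Integrable (fun x : ℝ => Complex.exp (u * x * Complex.I)) μ :=
  (integrable_const (1 : ℝ)).mono' (by fun_prop)
    (Eventually.of_forall fun x => (norm_exp_ofReal_mul_ofReal_mul_I u x).le)

/-- The second difference `-(f (u + s) - 2 f u + f (u - s)) / 2` of `f` at `u` with step `s`. On
characteristic exponents it removes the drift, and on `u ↦ e^{iux}` it acts as multiplication by
`1 - cos (s x)`. -/
noncomputable def secondDiff (f : ℝ → ℂ) (u s : ℝ) : ℂ :=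
  f u - f (u + s) / 2 - f (u - s) / 2

theorem secondDiff_const_mul (c : ℂ) (f : ℝ → ℂ) (u s : ℝ) :
    secondDiff (fun v => c * f v) u s = c * secondDiff f u s := by
  simp only [secondDiff]
  ring

theorem secondDiff_sub_one (f : ℝ → ℂ) (u s : ℝ) :
    secondDiff (fun v => f v - 1) u s = secondDiff f u s := by
  simp only [secondDiff]
  ring

theorem integral_secondDiff {α : Type*} [MeasurableSpace α] {μ : Measure α} {f : ℝ → α → ℂ}
    (hf : ∀ v, Integrable (f v) μ) (u s : ℝ) :
    ∫ x, secondDiff (fun v => f v x) u s ∂μ = secondDiff (fun v => ∫ x, f v x ∂μ) u s := by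
  simp only [secondDiff]
  have hdiff : Integrable (fun x => f u x - f (u + s) x / 2) μ := (hf u).sub ((hf _).div_const 2)
  rw [integral_sub hdiff ((hf _).div_const 2), integral_sub (hf u) ((hf _).div_const 2),
    integral_div, integral_div]

theorem norm_secondDiff_le {f : ℝ → ℂ} {u s r C : ℝ} (hf : ∀ v, |v| ≤ r → ‖f v‖ ≤ C)
    (hus : |u| + |s| ≤ r) : ‖secondDiff f u s‖ ≤ 2 * C := by
  have hcenter : ‖f u‖ ≤ C := hf u ((le_add_of_nonneg_right (abs_nonneg s)).trans hus)
  have hhalf : ∀ v, |v| ≤ r → ‖f v / 2‖ ≤ C / 2 := fun v hv => by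
    rw [norm_div, Complex.norm_ofNat]
    exact div_le_div_of_nonneg_right (hf v hv) zero_le_two
  calc ‖secondDiff f u s‖ ≤ ‖f u‖ + ‖f (u + s) / 2‖ + ‖f (u - s) / 2‖ :=
        (norm_sub_le _ _).trans (add_le_add_left (norm_sub_le _ _) _)
    _ ≤ C + C / 2 + C / 2 := add_le_add_three hcenter (hhalf _ ((abs_add_le u s).trans hus))
        (hhalf _ ((abs_sub u s).trans hus))
    _ = 2 * C := by ring

theorem tendsto_secondDiff {f : ℕ → ℝ → ℂ} {f₀ : ℝ → ℂ}
    (hf : ∀ v, Tendsto (fun n => f n v) atTop (𝓝 (f₀ v))) (u s : ℝ) :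
    Tendsto (fun n => secondDiff (f n) u s) atTop (𝓝 (secondDiff f₀ u s)) :=
  ((hf u).sub ((hf _).div_const 2)).sub ((hf _).div_const 2)

theorem secondDiff_exp (x u s : ℝ) :
    secondDiff (fun v => Complex.exp (v * x * Complex.I)) u s =
      Complex.exp (u * x * Complex.I) * ((1 - Real.cos (s * x) : ℝ) : ℂ) := by
  have hadd : ((u : ℂ) + s) * x * Complex.I = u * x * Complex.I + s * x * Complex.I := by ring
  have hsub : ((u : ℂ) - s) * x * Complex.I = u * x * Complex.I + -(s * x) * Complex.I := by ring
  simp only [secondDiff, Complex.ofReal_add, Complex.ofReal_sub, Complex.ofReal_one,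
    Complex.ofReal_cos, Complex.ofReal_mul, Complex.cos, hadd, hsub, Complex.exp_add]
  ring

theorem one_sub_cos_le {s : ℝ} (hs : |s| ≤ 1) (x : ℝ) :
    1 - Real.cos (s * x) ≤ 2 * min 1 (x ^ 2) := by
  rw [mul_min_of_nonneg _ _ zero_le_two]
  refine le_min (by linarith [Real.neg_one_le_cos (s * x)]) ?_
  have hcos := Real.one_sub_sq_div_two_le_cos (x := s * x)
  have hsq : s ^ 2 * x ^ 2 ≤ x ^ 2 :=
    mul_le_of_le_one_left (sq_nonneg x) ((sq_le_one_iff_abs_le_one s).2 hs)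
  rw [mul_pow] at hcos
  linarith [sq_nonneg x]

theorem norm_secondDiff_exp_le {s : ℝ} (hs : |s| ≤ 1) (u x : ℝ) :
    ‖secondDiff (fun v => Complex.exp (v * x * Complex.I)) u s‖ ≤ 2 * min 1 (x ^ 2) := by
  rw [secondDiff_exp, norm_mul, norm_exp_ofReal_mul_ofReal_mul_I, one_mul, Complex.norm_real,
    Real.norm_of_nonneg (sub_nonneg.2 (Real.cos_le_one _))]
  exact one_sub_cos_le hs x

/-- The weight `1 - sin x / x`: it is comparable to `min (1, x²)`, so it turns a Lévy measure into
a finite measure, whose characteristic function is an average of second differences of the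
characteristic exponent. -/
noncomputable def sincDefect (x : ℝ) : ℝ := 1 - Real.sinc x

theorem continuous_sincDefect : Continuous sincDefect :=
  continuous_const.sub Real.continuous_sinc

theorem sincDefect_zero : sincDefect 0 = 0 := by rw [sincDefect, Real.sinc_zero, sub_self]

theorem sincDefect_nonneg (x : ℝ) : 0 ≤ sincDefect x := sub_nonneg.2 (Real.sinc_le_one x)

theorem sincDefect_abs (x : ℝ) : sincDefect |x| = sincDefect x := by
  rcases abs_choice x with hx | hx <;> rw [hx]
  rw [sincDefect, Real.sinc_neg, sincDefect]

theorem sincDefect_pos {x : ℝ} (hx : x ≠ 0) : 0 < sincDefect x := by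
  have hpos := abs_pos.2 hx
  rw [← sincDefect_abs, sincDefect, Real.sinc_of_ne_zero hpos.ne', sub_pos, div_lt_one hpos]
  exact Real.sin_lt hpos

theorem mul_sincDefect (x : ℝ) : x * sincDefect x = x - Real.sin x := by
  rcases eq_or_ne x 0 with rfl | hx
  · rw [zero_mul, Real.sin_zero, sub_zero]
  · rw [sincDefect, Real.sinc_of_ne_zero hx, mul_sub, mul_one, mul_div_cancel₀ _ hx]

theorem sincDefect_eq_integral (x : ℝ) :
    sincDefect x = ∫ s in Set.Ioc (0 : ℝ) 1, (1 - Real.cos (s * x)) := by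
  rw [← intervalIntegral.integral_of_le zero_le_one, intervalIntegral.integral_sub
    intervalIntegrable_const (Continuous.intervalIntegrable (by fun_prop) _ _),
    intervalIntegral.integral_const, sub_zero, one_smul, sincDefect, sub_right_inj]
  rcases eq_or_ne x 0 with rfl | hx
  · simp
  · rw [intervalIntegral.integral_comp_mul_right Real.cos hx, integral_cos, zero_mul, one_mul,
      Real.sin_zero, sub_zero, Real.sinc_of_ne_zero hx, smul_eq_mul, inv_mul_eq_div]

theorem sincDefect_le (x : ℝ) : sincDefect x ≤ 2 * min 1 (x ^ 2) := by
  have hle : ∀ s ∈ Set.Ioc (0 : ℝ) 1, 1 - Real.cos (s * x) ≤ 2 * min 1 (x ^ 2) := fun s hs =>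
    one_sub_cos_le (abs_le.2 ⟨by linarith [hs.1], hs.2⟩) x
  calc sincDefect x ≤ ∫ s in Set.Ioc (0 : ℝ) 1, 2 * min 1 (x ^ 2) := by
        rw [sincDefect_eq_integral]
        exact setIntegral_mono_on ((Continuous.integrableOn_Icc (by fun_prop)).mono_set
          Set.Ioc_subset_Icc_self) (integrable_const _) measurableSet_Ioc hle
    _ = 2 * min 1 (x ^ 2) := by simp

theorem half_le_sincDefect {x : ℝ} (hx : 2 ≤ |x|) : 1 / 2 ≤ sincDefect x := by
  have hsinc := Real.sinc_le_inv_abs (abs_pos.1 (two_pos.trans_le hx))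
  have hinv : |x|⁻¹ ≤ 2⁻¹ := inv_anti₀ two_pos hx
  rw [sincDefect]
  linarith

theorem tendsto_sincDefect_div_sq :
    Tendsto (fun x => sincDefect x / x ^ 2) (𝓝[≠] 0) (𝓝 (1 / 6)) := by
  have hlim : Tendsto (fun x : ℝ => x ^ 2) (𝓝[≠] 0) (𝓝 0) :=
    ((continuous_pow 2).tendsto' 0 0 (by norm_num)).mono_left nhdsWithin_le_nhds
  rw [tendsto_iff_norm_sub_tendsto_zero]
  refine squeeze_zero' (Eventually.of_forall fun _ => norm_nonneg _) ?_ hlim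
  filter_upwards [self_mem_nhdsWithin,
    nhdsWithin_le_nhds (Metric.closedBall_mem_nhds (0 : ℝ) one_pos)] with x (hx : x ≠ 0) hx1
  rw [mem_closedBall_zero_iff, Real.norm_eq_abs] at hx1
  have hsin := Real.sin_bound hx1
  have heq : sincDefect x / x ^ 2 - 1 / 6 = -(Real.sin x - (x - x ^ 3 / 6)) / x ^ 3 := by
    rw [show Real.sin x = x - x * sincDefect x by rw [mul_sincDefect, sub_sub_cancel]]
    field_simp
    ring
  rw [heq, Real.norm_eq_abs, abs_div, abs_neg, div_le_iff₀ (by positivity), ← sq_abs, abs_pow,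
    ← pow_add]
  linarith [pow_nonneg (abs_nonneg x) 5]

section SincWeighted

variable {μ : Measure ℝ}

/-- The measure `(1 - sin x / x) μ(dx)`. -/
noncomputable def sincWeighted (μ : Measure ℝ) : Measure ℝ :=
  μ.withDensity fun x => ENNReal.ofReal (sincDefect x)

theorem integrable_sincDefect (hμ : Integrable (fun x : ℝ => min 1 (x ^ 2)) μ) :
    Integrable sincDefect μ := by
  refine (hμ.const_mul 2).mono' continuous_sincDefect.aestronglyMeasurable
    (Eventually.of_forall fun x => ?_)
  rw [Real.norm_of_nonneg (sincDefect_nonneg x)]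
  exact sincDefect_le x

theorem isFiniteMeasure_sincWeighted (hμ : Integrable (fun x : ℝ => min 1 (x ^ 2)) μ) :
    IsFiniteMeasure (sincWeighted μ) :=
  isFiniteMeasure_withDensity_ofReal (integrable_sincDefect hμ).2

theorem integral_sincWeighted {E : Type*} [NormedAddCommGroup E] [NormedSpace ℝ E] (μ : Measure ℝ)
    (H : ℝ → E) : ∫ x, H x ∂(sincWeighted μ) = ∫ x, sincDefect x • H x ∂μ := by
  rw [sincWeighted, integral_withDensity_eq_integral_toReal_smul
    continuous_sincDefect.measurable.ennreal_ofReal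
    (Eventually.of_forall fun _ => ENNReal.ofReal_lt_top)]
  simp only [ENNReal.toReal_ofReal (sincDefect_nonneg _)]

theorem integrable_secondDiff_exp_prod [SFinite μ]
    (hμ : Integrable (fun x : ℝ => min 1 (x ^ 2)) μ) (u : ℝ) :
    Integrable (fun z : ℝ × ℝ => secondDiff (fun v => Complex.exp (v * z.2 * Complex.I)) u z.1)
      ((volume.restrict (Set.Ioc (0 : ℝ) 1)).prod μ) := by
  refine ((hμ.comp_snd (volume.restrict (Set.Ioc (0 : ℝ) 1))).const_mul 2).mono' ?_ ?_
  · simp only [secondDiff]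
    exact Continuous.aestronglyMeasurable (by fun_prop)
  · filter_upwards [Measure.quasiMeasurePreserving_fst.ae (ae_restrict_mem measurableSet_Ioc)]
      with z hz
    exact norm_secondDiff_exp_le (abs_le.2 ⟨by linarith [hz.1], hz.2⟩) u z.2

theorem charFun_sincWeighted [SFinite μ] (hμ : Integrable (fun x : ℝ => min 1 (x ^ 2)) μ)
    (u : ℝ) : charFun (sincWeighted μ) u = ∫ s in Set.Ioc (0 : ℝ) 1,
      ∫ x : ℝ, secondDiff (fun v => Complex.exp (v * x * Complex.I)) u s ∂μ := by
  rw [integral_integral_swap (integrable_secondDiff_exp_prod hμ u), charFun_apply_real,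
    integral_sincWeighted]
  refine integral_congr_ae (Eventually.of_forall fun x => ?_)
  simp only [secondDiff_exp]
  rw [integral_const_mul, integral_complex_ofReal, ← sincDefect_eq_integral, Complex.real_smul,
    mul_comm]

theorem charFun_sincWeighted_of_isFiniteMeasure (μ : Measure ℝ) [IsFiniteMeasure μ] (u : ℝ) :
    charFun (sincWeighted μ) u = ∫ s in Set.Ioc (0 : ℝ) 1, secondDiff (charFun μ) u s := by
  rw [charFun_sincWeighted (integrable_min_one_sq μ)]
  simp only [integral_secondDiff (integrable_exp_mul_I μ), ← charFun_apply_real]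

end SincWeighted

/-- The integrand of the Lévy–Khintchine formula. -/
noncomputable def levyKernel (u x : ℝ) : ℂ :=
  Complex.exp (Complex.I * u * x) - 1 -
    Complex.I * u * Set.indicator {y : ℝ | |y| ≤ 1} (fun y => (y : ℂ)) x

/-- The characteristic exponent of the triplet `(γ, b², ν)`. -/
noncomputable def levyExponent (γ b : ℝ) (ν : Measure ℝ) (u : ℝ) : ℂ :=
  Complex.I * γ * u - (b : ℂ) ^ 2 * u ^ 2 / 2 + ∫ x : ℝ, levyKernel u x ∂ν

theorem measurable_levyKernel (u : ℝ) : Measurable (levyKernel u) := by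
  unfold levyKernel
  exact Measurable.sub (by fun_prop)
    ((Measurable.indicator (by fun_prop) (measurableSet_abs_le 1)).const_mul _)

theorem norm_exp_I_sub_one_sub_le (y : ℝ) :
    ‖Complex.exp (Complex.I * y) - 1 - Complex.I * y‖ ≤ 2 * y ^ 2 := by
  have hnorm : ‖Complex.I * (y : ℂ)‖ = |y| := by
    rw [norm_mul, Complex.norm_I, one_mul, Complex.norm_real, Real.norm_eq_abs]
  rcases le_or_gt |y| 1 with hy | hy
  · refine (Complex.norm_exp_sub_one_sub_id_le (hnorm.trans_le hy)).trans ?_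
    rw [hnorm, sq_abs]
    linarith [sq_nonneg y]
  · calc _ ≤ ‖Complex.exp (Complex.I * y) - 1‖ + ‖Complex.I * (y : ℂ)‖ := norm_sub_le _ _
      _ ≤ |y| + |y| := add_le_add Real.norm_exp_I_mul_ofReal_sub_one_le hnorm.le
      _ ≤ 2 * y ^ 2 := by rw [← sq_abs]; nlinarith

theorem norm_levyKernel_le (u x : ℝ) : ‖levyKernel u x‖ ≤ (2 * u ^ 2 + 2) * min 1 (x ^ 2) := by
  rw [levyKernel]
  by_cases hx : |x| ≤ 1
  · have hsmall := norm_exp_I_sub_one_sub_le (u * x)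
    push_cast at hsmall
    rw [Set.indicator_of_mem (s := {y : ℝ | |y| ≤ 1}) hx, mul_assoc,
      min_eq_right ((sq_le_one_iff_abs_le_one x).2 hx)]
    exact hsmall.trans (by nlinarith [sq_nonneg x])
  · have hsq : 1 ≤ x ^ 2 := (one_le_sq_iff_one_le_abs x).2 (not_le.1 hx).le
    have hexp : Complex.I * u * x = ((u * x : ℝ) : ℂ) * Complex.I := by push_cast; ring
    rw [Set.indicator_of_notMem (s := {y : ℝ | |y| ≤ 1}) hx, mul_zero, sub_zero, min_eq_left hsq,
      mul_one, hexp]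
    calc _ ≤ ‖Complex.exp (((u * x : ℝ) : ℂ) * Complex.I)‖ + ‖(1 : ℂ)‖ := norm_sub_le _ _
      _ = 2 := by rw [Complex.norm_exp_ofReal_mul_I, norm_one, one_add_one_eq_two]
      _ ≤ _ := le_add_of_nonneg_left (by positivity)

theorem secondDiff_levyKernel (x u s : ℝ) : secondDiff (fun v => levyKernel v x) u s =
    secondDiff (fun v => Complex.exp (v * x * Complex.I)) u s := by
  have hcomm : ∀ v : ℂ, Complex.I * v * x = v * x * Complex.I := fun v => by ring
  simp only [secondDiff, levyKernel, hcomm]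
  push_cast
  ring

section LevyExponent

variable {ν : Measure ℝ}

theorem integrable_levyKernel (hν : Integrable (fun x : ℝ => min 1 (x ^ 2)) ν) (u : ℝ) :
    Integrable (levyKernel u) ν :=
  (hν.const_mul (2 * u ^ 2 + 2)).mono' (measurable_levyKernel u).aestronglyMeasurable
    (Eventually.of_forall (norm_levyKernel_le u))

theorem exists_norm_levyExponent_le (hν : Integrable (fun x : ℝ => min 1 (x ^ 2)) ν)
    (γ b r : ℝ) : ∃ C, ∀ u, |u| ≤ r → ‖levyExponent γ b ν u‖ ≤ C := by
  refine ⟨|γ| * r + b ^ 2 * r ^ 2 / 2 + (2 * r ^ 2 + 2) * ∫ x : ℝ, min 1 (x ^ 2) ∂ν,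
    fun u hu => ?_⟩
  have hsq : u ^ 2 ≤ r ^ 2 := by rw [← sq_abs]; gcongr
  have hdrift : ‖Complex.I * (γ : ℂ) * u‖ ≤ |γ| * r := by
    simp only [norm_mul, Complex.norm_I, Complex.norm_real, one_mul, Real.norm_eq_abs]
    gcongr
  have hgauss : ‖(b : ℂ) ^ 2 * u ^ 2 / 2‖ ≤ b ^ 2 * r ^ 2 / 2 := by
    simp only [norm_mul, norm_div, norm_pow, Complex.norm_real, Real.norm_eq_abs, sq_abs,
      Complex.norm_ofNat]
    gcongr
  have hjump : ‖∫ x : ℝ, levyKernel u x ∂ν‖ ≤ (2 * r ^ 2 + 2) * ∫ x : ℝ, min 1 (x ^ 2) ∂ν := by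
    rw [← integral_const_mul]
    refine norm_integral_le_of_norm_le (hν.const_mul _) (Eventually.of_forall fun x => ?_)
    refine (norm_levyKernel_le u x).trans ?_
    gcongr
  exact (norm_add_le _ _).trans (add_le_add ((norm_sub_le _ _).trans (add_le_add hdrift hgauss))
    hjump)

theorem secondDiff_levyExponent (hν : Integrable (fun x : ℝ => min 1 (x ^ 2)) ν) (γ b u s : ℝ) :
    secondDiff (levyExponent γ b ν) u s = ((b ^ 2 / 2 * s ^ 2 : ℝ) : ℂ) +
      ∫ x : ℝ, secondDiff (fun v => Complex.exp (v * x * Complex.I)) u s ∂ν := by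
  simp only [← secondDiff_levyKernel]
  rw [integral_secondDiff (integrable_levyKernel hν)]
  simp only [secondDiff, levyExponent]
  push_cast
  ring

/-- The weak limit of `n (1 - sin x / x) p n(dx)` when `p n` is the law of an increment of length
`t / n` of a Lévy process with triplet `(γ, b², ν)`. The atom at `0` comes from the Gaussian part,
`1 - sin x / x` being equivalent to `x² / 6`. -/
noncomputable def limitMeasure (t : ℝ≥0) (b : ℝ) (ν : Measure ℝ) : Measure ℝ :=
  t • (sincWeighted ν + (b ^ 2 / 6).toNNReal • Measure.dirac 0)

theorem isFiniteMeasure_limitMeasure (hν : Integrable (fun x : ℝ => min 1 (x ^ 2)) ν) (t : ℝ≥0)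
    (b : ℝ) : IsFiniteMeasure (limitMeasure t b ν) := by
  have := isFiniteMeasure_sincWeighted hν
  unfold limitMeasure
  infer_instance

theorem integral_limitMeasure {E : Type*} [NormedAddCommGroup E] [NormedSpace ℝ E]
    [CompleteSpace E] {H : ℝ → E} (hH : Integrable H (sincWeighted ν)) (t : ℝ≥0) (b : ℝ) :
    ∫ x, H x ∂(limitMeasure t b ν) =
      (t : ℝ) • (∫ x, sincDefect x • H x ∂ν + (b ^ 2 / 6) • H 0) := by
  rw [limitMeasure, integral_smul_nnreal_measure, integral_add_measure hH
    ((integrable_dirac (by simp)).smul_measure_nnreal), integral_smul_nnreal_measure,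
    integral_dirac, integral_sincWeighted, NNReal.smul_def, NNReal.smul_def,
    Real.coe_toNNReal _ (by positivity)]

theorem charFun_limitMeasure [SFinite ν] (hν : Integrable (fun x : ℝ => min 1 (x ^ 2)) ν)
    (t : ℝ≥0) (γ b u : ℝ) :
    charFun (limitMeasure t b ν) u =
      ∫ s in Set.Ioc (0 : ℝ) 1, secondDiff (fun v => t * levyExponent γ b ν v) u s := by
  have := isFiniteMeasure_sincWeighted hν
  have hgauss : ∫ s in Set.Ioc (0 : ℝ) 1, ((b ^ 2 / 2 * s ^ 2 : ℝ) : ℂ) = (b ^ 2 / 6 : ℝ) := by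
    rw [integral_complex_ofReal, ← intervalIntegral.integral_of_le zero_le_one,
      intervalIntegral.integral_const_mul, integral_pow]
    norm_num
    ring
  simp only [secondDiff_const_mul, secondDiff_levyExponent hν]
  rw [integral_const_mul, integral_add ((Continuous.integrableOn_Icc (by fun_prop)).mono_set
    Set.Ioc_subset_Icc_self) (integrable_secondDiff_exp_prod hν u).integral_prod_left, hgauss,
    ← charFun_sincWeighted hν, charFun_apply_real, charFun_apply_real,
    integral_limitMeasure (integrable_exp_mul_I _ u), integral_sincWeighted]
  simp only [Complex.ofReal_zero, mul_zero, zero_mul, Complex.exp_zero, Complex.real_smul,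
    mul_one]
  rw [add_comm]

end LevyExponent

theorem tendsto_natCast_mul_exp_div_sub_one (z : ℂ) :
    Tendsto (fun n : ℕ => (n : ℂ) * (Complex.exp (z / n) - 1)) atTop (𝓝 z) := by
  have hderiv : HasDerivAt (fun w : ℂ => Complex.exp (z * w)) z 0 := by
    simpa using ((hasDerivAt_id (0 : ℂ)).const_mul z).cexp
  have hinv : Tendsto (fun n : ℕ => ((n : ℂ))⁻¹) atTop (𝓝[≠] 0) :=
    tendsto_nhdsWithin_iff.2 ⟨tendsto_inv_atTop_nhds_zero_nat, (eventually_ne_atTop 0).mono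
      fun n hn => inv_ne_zero (Nat.cast_ne_zero.2 hn)⟩
  refine (hderiv.tendsto_slope_zero.comp hinv).congr fun n => ?_
  simp [div_eq_mul_inv]

theorem norm_natCast_mul_exp_div_sub_one_le {z : ℂ} {r : ℝ} (hz : ‖z‖ ≤ r) (n : ℕ) :
    ‖(n : ℂ) * (Complex.exp (z / n) - 1)‖ ≤ r * Real.exp r := by
  have hexp : ‖Complex.exp (z / n) - 1‖ ≤ ‖z / n‖ * Real.exp ‖z / n‖ := by
    simpa using Complex.norm_exp_sub_sum_le_norm_mul_exp (z / n) 1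
  rw [norm_div, Complex.norm_natCast] at hexp
  have hr : 0 ≤ r := (norm_nonneg z).trans hz
  rcases eq_or_ne n 0 with rfl | hn
  · rw [Nat.cast_zero, zero_mul, norm_zero]
    positivity
  have hle : ‖z‖ / n ≤ r :=
    (div_le_self (norm_nonneg z) (Nat.one_le_cast.2 (Nat.one_le_iff_ne_zero.2 hn))).trans hz
  rw [norm_mul, Complex.norm_natCast]
  calc (n : ℝ) * ‖Complex.exp (z / n) - 1‖ ≤ n * (‖z‖ / n * Real.exp (‖z‖ / n)) := by gcongr
    _ = ‖z‖ * Real.exp (‖z‖ / n) := by field_simp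
    _ ≤ r * Real.exp r := by gcongr

theorem charFun_smul_sincWeighted (μ : Measure ℝ) [IsFiniteMeasure μ] (n : ℕ) (u : ℝ) :
    charFun ((n : ℝ≥0) • sincWeighted μ) u =
      ∫ s in Set.Ioc (0 : ℝ) 1, secondDiff (fun v => n * (charFun μ v - 1)) u s := by
  simp only [secondDiff_const_mul, secondDiff_sub_one]
  rw [integral_const_mul, ← charFun_sincWeighted_of_isFiniteMeasure, charFun_apply_real,
    charFun_apply_real, integral_smul_nnreal_measure, NNReal.smul_def, NNReal.coe_natCast,
    Complex.real_smul, Complex.ofReal_natCast]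

section Roots

variable {p : ℕ → Measure ℝ} [∀ n, IsProbabilityMeasure (p n)]

theorem tendsto_charFun_smul_sincWeighted {ψ : ℝ → ℂ}
    (hp : ∀ n u, charFun (p n) u = Complex.exp (ψ u / n))
    (hψ : ∀ r, ∃ C, ∀ u, |u| ≤ r → ‖ψ u‖ ≤ C) (u : ℝ) :
    Tendsto (fun n : ℕ => charFun ((n : ℝ≥0) • sincWeighted (p n)) u) atTop
      (𝓝 (∫ s in Set.Ioc (0 : ℝ) 1, secondDiff ψ u s)) := by
  obtain ⟨C, hC⟩ := hψ (|u| + 1)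
  simp only [charFun_smul_sincWeighted]
  refine tendsto_integral_of_dominated_convergence (fun _ => 2 * (C * Real.exp C)) (fun n => ?_)
    (integrable_const _) (fun n => ?_) (Eventually.of_forall fun s => ?_)
  · have : Measurable (charFun (p n)) := measurable_charFun
    unfold secondDiff
    exact Measurable.aestronglyMeasurable (by fun_prop)
  · filter_upwards [ae_restrict_mem measurableSet_Ioc] with s hs
    have hs1 : |s| ≤ 1 := abs_le.2 ⟨by linarith [hs.1], hs.2⟩
    refine norm_secondDiff_le (fun v hv => ?_) (add_le_add_right hs1 |u|)
    rw [hp]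
    exact norm_natCast_mul_exp_div_sub_one_le (hC v hv) n
  · refine tendsto_secondDiff (fun v => ?_) u s
    simp only [hp]
    exact tendsto_natCast_mul_exp_div_sub_one (ψ v)

variable {t : ℝ≥0} {γ b : ℝ} {ν : Measure ℝ}
  (hp : ∀ n u, charFun (p n) u = Complex.exp (t * levyExponent γ b ν u / n))

include hp

theorem tendsto_charFun_limitMeasure [SFinite ν]
    (hν : Integrable (fun x : ℝ => min 1 (x ^ 2)) ν) (u : ℝ) :
    Tendsto (fun n : ℕ => charFun ((n : ℝ≥0) • sincWeighted (p n)) u) atTop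
      (𝓝 (charFun (limitMeasure t b ν) u)) := by
  rw [charFun_limitMeasure hν t γ b u]
  refine tendsto_charFun_smul_sincWeighted hp (fun r => ?_) u
  obtain ⟨C, hC⟩ := exists_norm_levyExponent_le hν γ b r
  exact ⟨‖(t : ℂ)‖ * C, fun v hv => (norm_mul _ _).trans_le
    (mul_le_mul_of_nonneg_left (hC v hv) (norm_nonneg _))⟩

theorem tendsto_integral_sincDefect_mul [SFinite ν]
    (hν : Integrable (fun x : ℝ => min 1 (x ^ 2)) ν) {H : ℝ → ℝ} (hH : Continuous H) {C : ℝ}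
    (hC : ∀ x, |H x| ≤ C) :
    Tendsto (fun n : ℕ => (n : ℝ) * ∫ x, sincDefect x * H x ∂(p n)) atTop
      (𝓝 (t * (∫ x, sincDefect x * H x ∂ν + b ^ 2 / 6 * H 0))) := by
  have := isFiniteMeasure_limitMeasure hν t b
  have := isFiniteMeasure_sincWeighted hν
  have := fun n => isFiniteMeasure_sincWeighted (integrable_min_one_sq (p n))
  have hint : Integrable H (sincWeighted ν) :=
    (integrable_const C).mono' hH.aestronglyMeasurable (Eventually.of_forall hC)
  have hlim := tendsto_integral_of_tendsto_charFun (tendsto_charFun_limitMeasure hp hν) hH hC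
  rw [integral_limitMeasure hint] at hlim
  simpa only [integral_smul_nnreal_measure, integral_sincWeighted, NNReal.smul_def,
    NNReal.coe_natCast, smul_eq_mul] using hlim

end Roots

section SincRatio

variable {h : ℝ → ℝ} {c : ℝ}

/-- The quotient `h / sincDefect` of a function with `h x ∼ c x²` at `0`, extended by its limit
`6 c`. -/
noncomputable def sincRatio (h : ℝ → ℝ) (c : ℝ) : ℝ → ℝ :=
  Function.update (fun x => h x / sincDefect x) 0 (6 * c)

theorem sincDefect_mul_sincRatio (h0 : h 0 = 0) (c x : ℝ) :
    sincDefect x * sincRatio h c x = h x := by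
  rcases eq_or_ne x 0 with rfl | hx
  · rw [sincDefect_zero, zero_mul, h0]
  · rw [sincRatio, Function.update_of_ne hx, mul_div_cancel₀ _ (sincDefect_pos hx).ne']

theorem sincRatio_zero (h : ℝ → ℝ) (c : ℝ) : sincRatio h c 0 = 6 * c :=
  Function.update_self _ _ _

theorem continuous_sincRatio (hcont : Continuous h)
    (hc : Tendsto (fun x => h x / x ^ 2) (𝓝[≠] 0) (𝓝 c)) : Continuous (sincRatio h c) := by
  refine continuous_iff_continuousAt.2 fun x => ?_
  rcases eq_or_ne x 0 with rfl | hx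
  · rw [sincRatio, continuousAt_update_same, show 6 * c = c / (1 / 6) by ring]
    refine (hc.div tendsto_sincDefect_div_sq (by norm_num)).congr' ?_
    filter_upwards [self_mem_nhdsWithin] with x hx
    exact div_div_div_cancel_right₀ (pow_ne_zero 2 hx) _ _
  · exact (continuousAt_update_of_ne hx).2
      (hcont.continuousAt.div continuous_sincDefect.continuousAt (sincDefect_pos hx).ne')

theorem exists_abs_sincRatio_le (hcont : Continuous h)
    (hc : Tendsto (fun x => h x / x ^ 2) (𝓝[≠] 0) (𝓝 c)) {C : ℝ} (hC : ∀ x, |h x| ≤ C) :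
    ∃ D, ∀ x, |sincRatio h c x| ≤ D := by
  obtain ⟨D, hD⟩ := (isCompact_Icc (a := (-2 : ℝ)) (b := 2)).exists_bound_of_continuousOn
    (continuous_sincRatio hcont hc).continuousOn
  refine ⟨max D (C / (1 / 2)), fun x => ?_⟩
  rcases le_or_gt |x| 2 with hx | hx
  · exact (hD x (abs_le.1 hx)).trans (le_max_left _ _)
  · have hx0 : x ≠ 0 := abs_pos.1 (two_pos.trans hx)
    rw [sincRatio, Function.update_of_ne hx0, abs_div, abs_of_nonneg (sincDefect_nonneg x)]
    exact (div_le_div₀ ((abs_nonneg _).trans (hC x)) (hC x) one_half_pos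
      (half_le_sincDefect hx.le)).trans (le_max_right _ _)

theorem integrable_of_tendsto_div_sq {ν : Measure ℝ}
    (hν : Integrable (fun x : ℝ => min 1 (x ^ 2)) ν) (hcont : Continuous h) (h0 : h 0 = 0)
    (hc : Tendsto (fun x => h x / x ^ 2) (𝓝[≠] 0) (𝓝 c)) {C : ℝ} (hC : ∀ x, |h x| ≤ C) :
    Integrable h ν := by
  obtain ⟨D, hD⟩ := exists_abs_sincRatio_le hcont hc hC
  refine ((integrable_sincDefect hν).mul_const D).mono' hcont.aestronglyMeasurable
    (Eventually.of_forall fun x => ?_)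
  rw [← sincDefect_mul_sincRatio h0 c, norm_mul, Real.norm_of_nonneg (sincDefect_nonneg x)]
  exact mul_le_mul_of_nonneg_left (hD x) (sincDefect_nonneg x)

end SincRatio

theorem integral_sin_eq_im_charFun (μ : Measure ℝ) [IsFiniteMeasure μ] :
    ∫ x, Real.sin x ∂μ = (charFun μ 1).im := by
  rw [charFun_apply_real]
  refine Eq.trans (integral_congr_ae (Eventually.of_forall fun x => ?_))
    (integral_im (integrable_exp_mul_I μ 1))
  rw [RCLike.im_to_complex, Complex.ofReal_one, one_mul, Complex.exp_ofReal_mul_I_im]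

theorem im_levyKernel_one (x : ℝ) :
    (levyKernel 1 x).im = Real.sin x - Set.indicator {y : ℝ | |y| ≤ 1} id x := by
  have hind : Set.indicator {y : ℝ | |y| ≤ 1} (fun y => (y : ℂ)) x =
      (Set.indicator {y : ℝ | |y| ≤ 1} id x : ℝ) :=
    congrFun (Set.indicator_comp_of_zero Complex.ofReal_zero) x
  rw [levyKernel, hind, Complex.ofReal_one, mul_one, mul_comm Complex.I (x : ℂ), Complex.sub_im,
    Complex.sub_im, Complex.exp_ofReal_mul_I_im, Complex.one_im, sub_zero, Complex.I_mul_im,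
    Complex.ofReal_re]

section Drift

variable {ν : Measure ℝ} (hν : Integrable (fun x : ℝ => min 1 (x ^ 2)) ν)

include hν

theorem integrable_sin_sub_indicator :
    Integrable (fun x => Real.sin x - Set.indicator {y : ℝ | |y| ≤ 1} id x) ν := by
  simpa only [RCLike.im_to_complex, im_levyKernel_one] using (integrable_levyKernel hν 1).im

theorem im_levyExponent_one (γ b : ℝ) : (levyExponent γ b ν 1).im =
    γ + ∫ x, (Real.sin x - Set.indicator {y : ℝ | |y| ≤ 1} id x) ∂ν := by
  have hjump := integral_im (integrable_levyKernel hν 1)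
  simp only [RCLike.im_to_complex, im_levyKernel_one] at hjump
  have hgauss : (b : ℂ) ^ 2 * ((1 : ℝ) : ℂ) ^ 2 / 2 = ((b ^ 2 / 2 : ℝ) : ℂ) := by push_cast; ring
  rw [levyExponent, hgauss, Complex.add_im, Complex.sub_im, Complex.ofReal_im, ← hjump,
    Complex.ofReal_one, mul_one, Complex.I_mul_im, Complex.ofReal_re, sub_zero]

end Drift

theorem tendsto_exp_mul_sub_sin_div_sq (l : ℝ) :
    Tendsto (fun x : ℝ => (Real.exp (l * x) - 1 - l * Real.sin x) / x ^ 2) (𝓝[≠] 0)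
      (𝓝 (l ^ 2 / 2)) := by
  have hlx : Tendsto (fun x : ℝ => l * x) (𝓝 0) (𝓝 0) :=
    (continuous_const_mul l).tendsto' 0 0 (mul_zero l)
  have hexp : (fun x : ℝ => Real.exp (l * x) - (1 + l * x + (l * x) ^ 2 / 2)) =o[𝓝 0]
      fun x : ℝ => x ^ 2 := by
    have htaylor := (Real.exp_sub_sum_range_succ_isLittleO_pow 2).comp_tendsto hlx
    simp only [Function.comp_def, Finset.sum_range_succ, Finset.sum_range_zero, zero_add, pow_zero,
      pow_one, Nat.factorial_zero, Nat.factorial_one, Nat.factorial_two, Nat.cast_one, div_one,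
      Nat.cast_ofNat, mul_pow] at htaylor
    simpa only [mul_pow] using htaylor.trans_isBigO (Asymptotics.isBigO_const_mul_self _ _ _)
  have hsin : Tendsto (fun x => l * x * (sincDefect x / x ^ 2)) (𝓝[≠] 0) (𝓝 0) := by
    simpa only [zero_mul] using
      (hlx.mono_left nhdsWithin_le_nhds).mul tendsto_sincDefect_div_sq
  have hsum := ((hexp.tendsto_div_nhds_zero.mono_left
    (nhdsWithin_le_nhds (s := {0}ᶜ))).add hsin).add_const (l ^ 2 / 2)
  rw [zero_add, zero_add] at hsum
  refine hsum.congr' ?_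
  filter_upwards [self_mem_nhdsWithin] with x (hx : x ≠ 0)
  rw [show Real.sin x = x - x * sincDefect x by rw [mul_sincDefect, sub_sub_cancel]]
  field_simp
  ring

section Cutoff

variable {g : ℝ → ℝ}

theorem tendsto_exp_mul_comp_sub_sin_div_sq (hg0 : g =ᶠ[𝓝 0] id) (l : ℝ) :
    Tendsto (fun x : ℝ => (Real.exp (l * g x) - 1 - l * Real.sin x) / x ^ 2) (𝓝[≠] 0)
      (𝓝 (l ^ 2 / 2)) := by
  refine (tendsto_exp_mul_sub_sin_div_sq l).congr' ?_
  filter_upwards [nhdsWithin_le_nhds hg0] with x hx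
  rw [hx, id_eq]

theorem exp_mul_le_exp_abs_mul (l : ℝ) {y C : ℝ} (hy : |y| ≤ C) :
    Real.exp (l * y) ≤ Real.exp (|l| * C) :=
  Real.exp_le_exp.2 ((le_abs_self _).trans
    ((abs_mul l y).trans_le (mul_le_mul_of_nonneg_left hy (abs_nonneg l))))

theorem abs_exp_mul_sub_sin_le {C : ℝ} (hC : ∀ x, |g x| ≤ C) (l x : ℝ) :
    |Real.exp (l * g x) - 1 - l * Real.sin x| ≤ Real.exp (|l| * C) + 1 + |l| := by
  refine (abs_sub _ _).trans (add_le_add ((abs_sub _ _).trans ?_) ?_)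
  · rw [Real.abs_exp, abs_one]
    exact add_le_add_left (exp_mul_le_exp_abs_mul l (hC x)) 1
  · rw [abs_mul]
    exact mul_le_of_le_one_right (abs_nonneg l) (Real.abs_sin_le_one x)

/-- The exponent of the Laplace transform of a process with triplet `(γ, b², ν)` all of whose jumps
`x` have been replaced with `g x`. -/
noncomputable def laplaceExponent (γ b : ℝ) (ν : Measure ℝ) (g : ℝ → ℝ) (l : ℝ) : ℝ :=
  l * γ + b ^ 2 * l ^ 2 / 2 +
    ∫ x, (Real.exp (l * g x) - 1 - l * Set.indicator {y : ℝ | |y| ≤ 1} id x) ∂ν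

theorem laplaceExponent_eq {ν : Measure ℝ} (hν : Integrable (fun x : ℝ => min 1 (x ^ 2)) ν) {l : ℝ}
    (hint : Integrable (fun x => Real.exp (l * g x) - 1 - l * Real.sin x) ν) (γ b : ℝ) :
    laplaceExponent γ b ν g l =
      ∫ x, (Real.exp (l * g x) - 1 - l * Real.sin x) ∂ν + b ^ 2 * (l ^ 2 / 2) +
        l * (γ + ∫ x, (Real.sin x - Set.indicator {y : ℝ | |y| ≤ 1} id x) ∂ν) := by
  have hsplit : ∀ x, Real.exp (l * g x) - 1 - l * Set.indicator {y : ℝ | |y| ≤ 1} id x =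
      Real.exp (l * g x) - 1 - l * Real.sin x +
        l * (Real.sin x - Set.indicator {y : ℝ | |y| ≤ 1} id x) := fun x => by ring
  simp only [laplaceExponent, hsplit]
  rw [integral_add hint ((integrable_sin_sub_indicator hν).const_mul l), integral_const_mul]
  ring

end Cutoff

section RootsMgf

variable {p : ℕ → Measure ℝ} [∀ n, IsProbabilityMeasure (p n)] {t : ℝ≥0} {γ b : ℝ}
  {ν : Measure ℝ}
  (hp : ∀ n u, charFun (p n) u = Complex.exp (t * levyExponent γ b ν u / n))
  (hν : Integrable (fun x : ℝ => min 1 (x ^ 2)) ν)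

include hp hν

theorem tendsto_integral_sin :
    Tendsto (fun n : ℕ => (n : ℝ) * ∫ x, Real.sin x ∂(p n)) atTop
      (𝓝 (t * (γ + ∫ x, (Real.sin x - Set.indicator {y : ℝ | |y| ≤ 1} id x) ∂ν))) := by
  have hlim := (Complex.continuous_im.tendsto _).comp
    (tendsto_natCast_mul_exp_div_sub_one (t * levyExponent γ b ν 1))
  rw [Complex.im_ofReal_mul, im_levyExponent_one hν] at hlim
  refine hlim.congr fun n => ?_
  rw [Function.comp_apply, integral_sin_eq_im_charFun, hp, ← Complex.ofReal_natCast,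
    Complex.im_ofReal_mul, Complex.sub_im, Complex.one_im, sub_zero]

variable [SFinite ν]

theorem tendsto_integral_of_tendsto_div_sq {h : ℝ → ℝ} {c C : ℝ} (hcont : Continuous h)
    (h0 : h 0 = 0) (hc : Tendsto (fun x => h x / x ^ 2) (𝓝[≠] 0) (𝓝 c)) (hC : ∀ x, |h x| ≤ C) :
    Tendsto (fun n : ℕ => (n : ℝ) * ∫ x, h x ∂(p n)) atTop (𝓝 (t * (∫ x, h x ∂ν + b ^ 2 * c))) := by
  obtain ⟨D, hD⟩ := exists_abs_sincRatio_le hcont hc hC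
  have hlim := tendsto_integral_sincDefect_mul hp hν (continuous_sincRatio hcont hc) hD
  have h6 : b ^ 2 / 6 * (6 * c) = b ^ 2 * c := by ring
  simpa only [sincDefect_mul_sincRatio h0, sincRatio_zero, h6] using hlim

theorem tendsto_natCast_mul_mgf_sub_one {g : ℝ → ℝ} {C : ℝ} (hg : Continuous g)
    (hg0 : g =ᶠ[𝓝 0] id) (hC : ∀ x, |g x| ≤ C) (l : ℝ) :
    Tendsto (fun n : ℕ => (n : ℝ) * (mgf g (p n) l - 1)) atTop
      (𝓝 (t * laplaceExponent γ b ν g l)) := by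
  have hzero : Real.exp (l * g 0) - 1 - l * Real.sin 0 = 0 := by
    rw [hg0.eq_of_nhds, id_eq, Real.sin_zero, mul_zero, Real.exp_zero, sub_self, sub_zero]
  have hcont : Continuous fun x => Real.exp (l * g x) - 1 - l * Real.sin x := by fun_prop
  have hdiv := tendsto_exp_mul_comp_sub_sin_div_sq hg0 l
  have hbound := abs_exp_mul_sub_sin_le hC l
  rw [laplaceExponent_eq hν (integrable_of_tendsto_div_sq hν hcont hzero hdiv hbound), mul_add,
    mul_left_comm _ l]
  refine ((tendsto_integral_of_tendsto_div_sq hp hν hcont hzero hdiv hbound).add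
    ((tendsto_integral_sin hp hν).const_mul l)).congr fun n => ?_
  have hexp : Integrable (fun x => Real.exp (l * g x)) (p n) :=
    (integrable_const (Real.exp (|l| * C))).mono' (by fun_prop) (Eventually.of_forall fun x =>
      (Real.norm_of_nonneg (Real.exp_pos _).le).trans_le (exp_mul_le_exp_abs_mul l (hC x)))
  have hsin : Integrable Real.sin (p n) :=
    (integrable_const (1 : ℝ)).mono' (by fun_prop) (Eventually.of_forall Real.abs_sin_le_one)
  have hsub : Integrable (fun x => Real.exp (l * g x) - 1) (p n) := hexp.sub (integrable_const 1)
  rw [integral_sub hsub (hsin.const_mul l), integral_sub hexp (integrable_const 1),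
    integral_const_mul, integral_const, probReal_univ, one_smul, mgf]
  ring

end RootsMgf

section UniformIntegrability

theorem norm_indicator_nnnorm_ge_le_sq_div {Ω : Type*} {C : ℝ≥0} (hC : 0 < C) (f : Ω → ℝ)
    (ω : Ω) :
    ‖Set.indicator {ω | C ≤ ‖f ω‖₊} f ω‖ ≤ f ω ^ 2 / C := by
  by_cases hω : ω ∈ {ω | C ≤ ‖f ω‖₊}
  · have hle : (C : ℝ) ≤ |f ω| := by exact_mod_cast hω
    rw [Set.indicator_of_mem hω, Real.norm_eq_abs, le_div_iff₀ (by exact_mod_cast hC),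
      ← sq_abs, sq]
    gcongr
  · rw [Set.indicator_of_notMem hω, norm_zero]
    positivity

variable {Ω ι : Type*} [MeasurableSpace Ω] {P : Measure Ω}

theorem uniformIntegrable_of_integral_sq_le [IsFiniteMeasure P] {Y : ι → Ω → ℝ} {K : ℝ}
    (hY : ∀ i, AEStronglyMeasurable (Y i) P) (hsq : ∀ i, Integrable (fun ω => Y i ω ^ 2) P)
    (hK : ∀ i, ∫ ω, Y i ω ^ 2 ∂P ≤ K) : UniformIntegrable Y 1 P := by
  refine uniformIntegrable_of le_rfl ENNReal.one_ne_top hY fun ε hε => ?_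
  have hC : 0 < (K / ε).toNNReal + 1 := by positivity
  refine ⟨(K / ε).toNNReal + 1, fun i => ?_⟩
  rw [eLpNorm_one_eq_lintegral_enorm]
  calc ∫⁻ ω, ‖Set.indicator {ω | (K / ε).toNNReal + 1 ≤ ‖Y i ω‖₊} (Y i) ω‖ₑ ∂P
      ≤ ∫⁻ ω, ENNReal.ofReal (Y i ω ^ 2 / ((K / ε).toNNReal + 1 : ℝ≥0)) ∂P := by
        refine lintegral_mono fun ω => ?_
        rw [← ofReal_norm]
        exact ENNReal.ofReal_le_ofReal (norm_indicator_nnnorm_ge_le_sq_div hC (Y i) ω)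
    _ = ENNReal.ofReal ((∫ ω, Y i ω ^ 2 ∂P) / ((K / ε).toNNReal + 1 : ℝ≥0)) := by
        rw [← integral_div, ofReal_integral_eq_lintegral_ofReal ((hsq i).div_const _)
          (Eventually.of_forall fun ω => by positivity)]
    _ ≤ ENNReal.ofReal ε := by
        refine ENNReal.ofReal_le_ofReal ?_
        rw [div_le_iff₀ (by exact_mod_cast hC), ← div_le_iff₀' hε]
        calc (∫ ω, Y i ω ^ 2 ∂P) / ε ≤ K / ε := by gcongr; exact hK i
          _ ≤ ((K / ε).toNNReal + 1 : ℝ≥0) := by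
            push_cast
            exact (Real.le_coe_toNNReal _).trans (le_add_of_nonneg_right zero_le_one)

theorem integral_eq_of_tendsto_of_uniformIntegrable [IsFiniteMeasure P] {Y : ℕ → Ω → ℝ}
    {Z : Ω → ℝ} {M : ℝ} (hY : UniformIntegrable Y 1 P)
    (hYZ : ∀ᵐ ω ∂P, Tendsto (fun n => Y n ω) atTop (𝓝 (Z ω)))
    (hM : Tendsto (fun n => ∫ ω, Y n ω ∂P) atTop (𝓝 M)) : ∫ ω, Z ω ∂P = M := by
  have hZ : MemLp Z 1 P := hY.memLp_of_ae_tendsto hYZ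
  have hL1 := tendsto_Lp_finite_of_tendsto_ae le_rfl ENNReal.one_ne_top hY.1 hZ hY.2.1 hYZ
  exact tendsto_nhds_unique (tendsto_integral_of_L1' Z hZ.aestronglyMeasurable
    (Eventually.of_forall fun n => memLp_one_iff_integrable.1 (hY.memLp n)) hL1) hM

variable [IsFiniteMeasure P] {S : ℕ → Ω → ℝ} {Z : Ω → ℝ} {M : ℝ → ℝ}

theorem uniformIntegrable_exp_mul_of_tendsto_mgf
    (hint : ∀ n l, Integrable (fun ω => Real.exp (l * S n ω)) P)
    (hM : ∀ l, Tendsto (fun n => mgf (S n) P l) atTop (𝓝 (M l))) (l : ℝ) :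
    UniformIntegrable (fun n ω => Real.exp (l * S n ω)) 1 P := by
  have hsq (n : ℕ) (ω : Ω) : Real.exp (l * S n ω) ^ 2 = Real.exp (2 * l * S n ω) := by
    rw [← Real.exp_nat_mul]
    push_cast
    ring_nf
  obtain ⟨K, hK⟩ := (hM (2 * l)).bddAbove_range
  refine uniformIntegrable_of_integral_sq_le (K := K)
    (fun n => (hint n l).aestronglyMeasurable) (fun n => ?_) (fun n => ?_)
  · simpa only [hsq] using hint n (2 * l)
  · simpa only [hsq, mgf] using hK ⟨n, rfl⟩

theorem mgf_eq_of_tendsto (hint : ∀ n l, Integrable (fun ω => Real.exp (l * S n ω)) P)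
    (hSZ : ∀ᵐ ω ∂P, Tendsto (fun n => S n ω) atTop (𝓝 (Z ω)))
    (hM : ∀ l, Tendsto (fun n => mgf (S n) P l) atTop (𝓝 (M l))) (l : ℝ) :
    Integrable (fun ω => Real.exp (l * Z ω)) P ∧ mgf Z P l = M l := by
  have hUI := uniformIntegrable_exp_mul_of_tendsto_mgf hint hM l
  have hlim : ∀ᵐ ω ∂P, Tendsto (fun n => Real.exp (l * S n ω)) atTop
      (𝓝 (Real.exp (l * Z ω))) := by
    filter_upwards [hSZ] with ω hω
    exact (Real.continuous_exp.tendsto _).comp (hω.const_mul l)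
  exact ⟨memLp_one_iff_integrable.1 (hUI.memLp_of_ae_tendsto hlim),
    integral_eq_of_tendsto_of_uniformIntegrable hUI hlim (hM l)⟩

theorem integrable_exp_mul_of_abs_le {Y : Ω → ℝ} (hY : AEMeasurable Y P) {C : ℝ}
    (hC : ∀ ω, |Y ω| ≤ C) (l : ℝ) : Integrable (fun ω => Real.exp (l * Y ω)) P := by
  refine (integrable_const (Real.exp (|l| * C))).mono'
    ((hY.const_mul l).exp).aestronglyMeasurable (Eventually.of_forall fun ω => ?_)
  rw [Real.norm_of_nonneg (Real.exp_pos _).le]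
  exact exp_mul_le_exp_abs_mul l (hC ω)

end UniformIntegrability

section LevyProcess

variable {Ω : Type*} [MeasurableSpace Ω] {P : Measure Ω} {X : ℝ≥0 → Ω → ℝ}
  {γ b : ℝ} {ν : Measure ℝ}

theorem IsLevyProcess.charFun_map_div (hX : IsLevyProcess P X) (hT : HasTriplet P X γ b ν)
    (t : ℝ≥0) (n : ℕ) (u : ℝ) :
    charFun (P.map (X (t / n))) u = Complex.exp (t * levyExponent γ b ν u / n) := by
  rw [charFun_apply_real, integral_map (hX.measurable _).aemeasurable (by fun_prop)]
  have h := hT.charFun_eq (t / n) u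
  simp_rw [show ∀ x : ℝ, (u : ℂ) * x * Complex.I = Complex.I * u * x from fun x => by ring, h,
    levyExponent, levyKernel]
  push_cast
  ring_nf

theorem IsLevyProcess.measurable_gridSum (hX : IsLevyProcess P X) {g : ℝ → ℝ}
    (hg : Measurable g) (t : ℝ≥0) (n : ℕ) :
    Measurable fun ω => gridSum g (fun s => X s ω) t n :=
  Finset.measurable_sum _ fun _ _ => hg.comp ((hX.measurable _).sub (hX.measurable _))

theorem abs_gridSum_le {g : ℝ → ℝ} {C : ℝ} (hC : ∀ y, |g y| ≤ C) (x : ℝ≥0 → ℝ) (t : ℝ≥0)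
    (n : ℕ) : |gridSum g x t n| ≤ n * C :=
  (Finset.abs_sum_le_sum_abs _ _).trans <|
    (Finset.sum_le_card_nsmul _ _ C fun _ _ => hC _).trans_eq <| by
      rw [Finset.card_range, nsmul_eq_mul]

theorem IsLevyProcess.identDistrib_gridIncrement (hX : IsLevyProcess P X) (t : ℝ≥0) (n k : ℕ) :
    IdentDistrib (fun ω => gridIncrement (fun s => X s ω) t n k) (X (t / n)) P P := by
  simp only [gridIncrement, gridPoint_succ]
  exact hX.stationary (gridPoint t n k) (t / n)

theorem IsLevyProcess.mgf_gridSum (hX : IsLevyProcess P X)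
    {g : ℝ → ℝ} (hg : Measurable g) (t : ℝ≥0) (n : ℕ) (l : ℝ) :
    mgf (fun ω => gridSum g (fun s => X s ω) t n) P l = mgf g (P.map (X (t / n))) l ^ n := by
  have hind : iIndepFun (fun k ω => g (gridIncrement (fun s => X s ω) t n k)) P :=
    (hX.indep.nat (gridPoint_mono t n)).comp (fun _ => g) fun _ => hg
  have hmeas (k : ℕ) : Measurable fun ω => g (gridIncrement (fun s => X s ω) t n k) :=
    hg.comp ((hX.measurable _).sub (hX.measurable _))
  have hsum : (fun ω => gridSum g (fun s => X s ω) t n) =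
      ∑ k ∈ Finset.range n, fun ω => g (gridIncrement (fun s => X s ω) t n k) := by
    ext ω
    rw [Finset.sum_apply, gridSum]
  have hterm (k : ℕ) : mgf (fun ω => g (gridIncrement (fun s => X s ω) t n k)) P l =
      mgf g (P.map (X (t / n))) l := by
    rw [mgf_map (hX.measurable _).aemeasurable ((hg.const_mul l).exp.aestronglyMeasurable)]
    exact congrFun (mgf_congr_identDistrib ((hX.identDistrib_gridIncrement t n k).comp hg)) l
  rw [hsum, hind.mgf_sum hmeas, Finset.prod_congr rfl fun k _ => hterm k, Finset.prod_const,
    Finset.card_range]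

theorem IsLevyProcess.tendsto_mgf_gridSum [IsProbabilityMeasure P] (hX : IsLevyProcess P X)
    (hT : HasTriplet P X γ b ν) (t : ℝ≥0) {g : ℝ → ℝ} {C : ℝ} (hg : Continuous g)
    (hg0 : g =ᶠ[𝓝 0] id) (hC : ∀ x, |g x| ≤ C) (l : ℝ) :
    Tendsto (fun n => mgf (fun ω => gridSum g (fun s => X s ω) t n) P l) atTop
      (𝓝 (Real.exp (t * laplaceExponent γ b ν g l))) := by
  have hprob (n : ℕ) : IsProbabilityMeasure (P.map (X (t / n))) :=
    Measure.isProbabilityMeasure_map (hX.measurable _).aemeasurable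
  have := hT.levyMeasure.sigmaFinite
  have h := Real.tendsto_one_add_pow_exp_of_tendsto <| tendsto_natCast_mul_mgf_sub_one
    (hX.charFun_map_div hT t) hT.levyMeasure.integrable hg hg0 hC l
  refine h.congr fun n => ?_
  rw [hX.mgf_gridSum hg.measurable, add_sub_cancel]

theorem IsLevyProcess.ae_tendsto_gridSum (hX : IsLevyProcess P X) (t : ℝ≥0) {g : ℝ → ℝ}
    (hg : Continuous g) {ε : ℝ} (hε : 0 < ε) (hgε : ∀ y, |y| ≤ ε → g y = y) :
    ∀ᵐ ω ∂P, Tendsto (fun n => gridSum g (fun s => X s ω) t n) atTop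
      (𝓝 (X t ω - largeJumpSum (fun y => y - g y) (fun s => X s ω) ε t)) := by
  filter_upwards [hX.zero, hX.cadlag] with ω h0 hc
  have h := hc.tendsto_gridSum t hε (f := fun y => y - g y) (by fun_prop)
    fun y hy => by rw [hgε y hy, sub_self]
  refine (h.const_sub (X t ω)).congr' ?_
  filter_upwards [eventually_ne_atTop 0] with n hn
  have hsplit : gridSum (fun y => y - g y) (fun s => X s ω) t n =
      gridSum (fun y => y) (fun s => X s ω) t n - gridSum g (fun s => X s ω) t n :=
    Finset.sum_sub_distrib _ _
  rw [hsplit, gridSum_id _ _ hn, h0]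
  ring

theorem eventually_eq_id_of_abs_le {g : ℝ → ℝ} {ε : ℝ} (hε : 0 < ε)
    (hgε : ∀ y, |y| ≤ ε → g y = y) : g =ᶠ[𝓝 0] id := by
  filter_upwards [Metric.closedBall_mem_nhds (0 : ℝ) hε] with y hy
  exact hgε y (by rwa [← Real.norm_eq_abs, ← mem_closedBall_zero_iff])

theorem IsLevyProcess.mgf_sub_largeJumpSum [IsProbabilityMeasure P] (hX : IsLevyProcess P X)
    (hT : HasTriplet P X γ b ν) (t : ℝ≥0) {g : ℝ → ℝ} (hg : Continuous g) {ε : ℝ} (hε : 0 < ε)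
    (hgε : ∀ y, |y| ≤ ε → g y = y) {C : ℝ} (hC : ∀ y, |g y| ≤ C) (l : ℝ) :
    Integrable (fun ω => Real.exp (l * (X t ω -
      largeJumpSum (fun y => y - g y) (fun s => X s ω) ε t))) P ∧
    mgf (fun ω => X t ω - largeJumpSum (fun y => y - g y) (fun s => X s ω) ε t) P l =
      Real.exp (t * laplaceExponent γ b ν g l) :=
  mgf_eq_of_tendsto (M := fun l => Real.exp (t * laplaceExponent γ b ν g l))
    (fun n => integrable_exp_mul_of_abs_le (hX.measurable_gridSum hg.measurable t n).aemeasurable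
      fun ω => abs_gridSum_le hC (fun s => X s ω) t n)
    (hX.ae_tendsto_gridSum t hg hε hgε)
    (hX.tendsto_mgf_gridSum hT t hg (eventually_eq_id_of_abs_le hε hgε) hC) l

end LevyProcess

section ExpTail

/-- The exponential function minus the first `n` terms of its Taylor expansion at `0`. -/
noncomputable def expTail (n : ℕ) (y : ℝ) : ℝ :=
  Real.exp y - ∑ i ∈ Finset.range n, y ^ i / i.factorial

theorem continuous_expTail (n : ℕ) : Continuous (expTail n) := by
  unfold expTail
  fun_prop

theorem expTail_zero (y : ℝ) : expTail 0 y = Real.exp y := by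
  rw [expTail, Finset.sum_range_zero, sub_zero]

theorem expTail_two (y : ℝ) : expTail 2 y = Real.exp y - 1 - y := by
  rw [expTail, Finset.sum_range_succ, Finset.sum_range_one, Nat.factorial_zero,
    Nat.factorial_one, Nat.cast_one, pow_zero, pow_one, div_one, div_one, sub_sub]

theorem expTail_succ_zero (n : ℕ) : expTail (n + 1) 0 = 0 := by
  rw [expTail, Finset.sum_range_succ', Real.exp_zero]
  simp

theorem abs_expTail_le (n : ℕ) (y : ℝ) : |expTail n y| ≤ |y| ^ n * Real.exp |y| := by
  have h := Complex.norm_exp_sub_sum_le_norm_mul_exp (y : ℂ) n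
  rw [Complex.norm_real, Real.norm_eq_abs] at h
  rw [← Real.norm_eq_abs, ← Complex.norm_real, expTail]
  exact_mod_cast h

theorem hasDerivAt_expTail (n : ℕ) (y : ℝ) : HasDerivAt (expTail n) (expTail (n - 1) y) y := by
  rcases n with _ | n
  · rw [Nat.zero_sub, funext expTail_zero]
    exact Real.hasDerivAt_exp y
  · have hterm (i : ℕ) : HasDerivAt (fun y : ℝ => y ^ (i + 1) / ((i + 1).factorial : ℝ))
        (y ^ i / i.factorial) y := by
      refine ((hasDerivAt_pow (i + 1) y).div_const _).congr_deriv ?_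
      rw [Nat.factorial_succ, Nat.add_sub_cancel]
      push_cast
      field_simp
    have hsum : expTail (n + 1) = fun y =>
        Real.exp y - ((∑ i ∈ Finset.range n, y ^ (i + 1) / ((i + 1).factorial : ℝ)) + 1) := by
      funext y
      rw [expTail, Finset.sum_range_succ', pow_zero, Nat.factorial_zero, Nat.cast_one, div_one]
    rw [hsum]
    exact (Real.hasDerivAt_exp y).sub
      ((HasDerivAt.fun_sum fun i _ => hterm i).add_const 1)

end ExpTail

section CompensatedExponent

/-- The `j`-th derivative of `l ↦ ∫ (e^{l x} - 1 - l x) μ(dx)`, the exponent of compensated jumps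
of intensity `μ`. The truncated difference `2 - j` counts the Taylor terms that survive `j`
differentiations. -/
noncomputable def compensatedExponent (μ : Measure ℝ) (j : ℕ) (l : ℝ) : ℝ :=
  ∫ x, x ^ j * expTail (2 - j) (l * x) ∂μ

variable {μ : Measure ℝ} {r : ℝ}

theorem compensatedExponent_zero (l : ℝ) :
    compensatedExponent μ 0 l = ∫ x, (Real.exp (l * x) - 1 - l * x) ∂μ := by
  simp only [compensatedExponent, pow_zero, one_mul, Nat.sub_zero, expTail_two]

theorem compensatedExponent_at_zero_of_lt_two {j : ℕ} (hj : j < 2) :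
    compensatedExponent μ j 0 = 0 := by
  obtain ⟨n, hn⟩ := Nat.exists_eq_succ_of_ne_zero (Nat.sub_ne_zero_of_lt hj)
  simp only [compensatedExponent, zero_mul, hn, Nat.succ_eq_add_one, expTail_succ_zero, mul_zero,
    integral_zero]

theorem compensatedExponent_at_zero_of_two_le {j : ℕ} (hj : 2 ≤ j) :
    compensatedExponent μ j 0 = ∫ x, x ^ j ∂μ := by
  simp only [compensatedExponent, zero_mul, Nat.sub_eq_zero_of_le hj, expTail_zero, Real.exp_zero,
    mul_one]

theorem abs_pow_mul_expTail_le (j : ℕ) {l m x : ℝ} (hl : |l| ≤ m) (hx : |x| ≤ r) :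
    |x ^ j * expTail (2 - j) (l * x)| ≤ m ^ (2 - j) * r ^ (j - 2) * Real.exp (m * r) * x ^ 2 := by
  have hm : 0 ≤ m := (abs_nonneg l).trans hl
  have hr : 0 ≤ r := (abs_nonneg x).trans hx
  have hlx : |l * x| ≤ m * r := (abs_mul l x).trans_le (by gcongr)
  calc |x ^ j * expTail (2 - j) (l * x)|
      ≤ |x| ^ j * (|l * x| ^ (2 - j) * Real.exp |l * x|) := by
        rw [abs_mul, abs_pow]
        gcongr
        exact abs_expTail_le _ _
    _ = |l| ^ (2 - j) * |x| ^ (j - 2) * Real.exp |l * x| * x ^ 2 := by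
        have hpow : |x| ^ j * |x| ^ (2 - j) = |x| ^ (j - 2) * x ^ 2 := by
          rw [← sq_abs x, ← pow_add, ← pow_add]
          congr 1
          omega
        rw [abs_mul l x, mul_pow]
        linear_combination |l| ^ (2 - j) * Real.exp (|l| * |x|) * hpow
    _ ≤ m ^ (2 - j) * r ^ (j - 2) * Real.exp (m * r) * x ^ 2 := by gcongr

variable (hsq : Integrable (fun x : ℝ => x ^ 2) μ) (hr : ∀ᵐ x ∂μ, |x| ≤ r)

include hsq hr

theorem integrable_pow_mul_expTail (j : ℕ) (l : ℝ) :
    Integrable (fun x => x ^ j * expTail (2 - j) (l * x)) μ := by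
  have hcont := continuous_expTail (2 - j)
  refine (hsq.const_mul (|l| ^ (2 - j) * r ^ (j - 2) * Real.exp (|l| * r))).mono'
    (by fun_prop) ?_
  filter_upwards [hr] with x hx
  exact abs_pow_mul_expTail_le j le_rfl hx

theorem hasDerivAt_compensatedExponent (j : ℕ) (l : ℝ) :
    HasDerivAt (compensatedExponent μ j) (compensatedExponent μ (j + 1) l) l := by
  have hmeas (j : ℕ) (l : ℝ) : AEStronglyMeasurable (fun x => x ^ j * expTail (2 - j) (l * x)) μ :=
    (integrable_pow_mul_expTail hsq hr j l).aestronglyMeasurable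
  refine (hasDerivAt_integral_of_dominated_loc_of_deriv_le (Metric.ball_mem_nhds l one_pos)
    (Eventually.of_forall (hmeas j)) (integrable_pow_mul_expTail hsq hr j l)
    (F' := fun l x => x ^ (j + 1) * expTail (2 - (j + 1)) (l * x)) (hmeas (j + 1) l)
    (bound := fun x => (|l| + 1) ^ (2 - (j + 1)) * r ^ (j + 1 - 2) * Real.exp ((|l| + 1) * r) *
      x ^ 2) ?_ (hsq.const_mul _) ?_).2
  · filter_upwards [hr] with x hx m hm
    refine abs_pow_mul_expTail_le (j + 1) ?_ hx
    have hdist : |m - l| < 1 := hm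
    linarith [abs_sub_abs_le_abs_sub m l]
  · refine Eventually.of_forall fun x m _ => ?_
    have hderiv := ((hasDerivAt_expTail (2 - j) (m * x)).comp m
      ((hasDerivAt_id m).mul_const x)).const_mul (x ^ j)
    refine hderiv.congr_deriv ?_
    rw [Nat.sub_sub]
    ring

end CompensatedExponent

section FourthDerivative

theorem iteratedDeriv_four_exp {f : ℕ → ℝ → ℝ} (hf : ∀ k x, HasDerivAt (f k) (f (k + 1) x) x)
    (x : ℝ) : iteratedDeriv 4 (fun x => Real.exp (f 0 x)) x =
      (f 4 x + 4 * f 1 x * f 3 x + 3 * f 2 x ^ 2 + 6 * f 1 x ^ 2 * f 2 x + f 1 x ^ 4) *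
        Real.exp (f 0 x) := by
  have hexp (x : ℝ) : HasDerivAt (fun x => Real.exp (f 0 x)) (Real.exp (f 0 x) * f 1 x) x :=
    (hf 0 x).exp
  have h1 : deriv (fun x => Real.exp (f 0 x)) = fun x => f 1 x * Real.exp (f 0 x) :=
    funext fun x => (hexp x).deriv.trans (mul_comm _ _)
  have h2 : deriv (fun x => f 1 x * Real.exp (f 0 x)) =
      fun x => (f 2 x + f 1 x ^ 2) * Real.exp (f 0 x) := funext fun x => by
    rw [((hf 1 x).fun_mul (hexp x)).deriv]
    ring
  have h3 : deriv (fun x => (f 2 x + f 1 x ^ 2) * Real.exp (f 0 x)) =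
      fun x => (f 3 x + 3 * f 1 x * f 2 x + f 1 x ^ 3) * Real.exp (f 0 x) := funext fun x => by
    rw [(((hf 2 x).fun_add ((hf 1 x).fun_pow 2)).fun_mul (hexp x)).deriv]
    ring
  rw [iteratedDeriv_succ, iteratedDeriv_succ, iteratedDeriv_succ, iteratedDeriv_one, h1, h2, h3,
    ((((hf 3 x).fun_add (((hf 1 x).const_mul 3).fun_mul (hf 2 x))).fun_add
      ((hf 1 x).fun_pow 3)).fun_mul (hexp x)).deriv]
  ring

theorem iteratedDeriv_four_exp_compensatedExponent {μ : Measure ℝ} {r : ℝ}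
    (hsq : Integrable (fun x : ℝ => x ^ 2) μ) (hr : ∀ᵐ x ∂μ, |x| ≤ r) (t : ℝ) :
    iteratedDeriv 4 (fun l => Real.exp (t * compensatedExponent μ 0 l)) 0 =
      t * ∫ x, x ^ 4 ∂μ + 3 * (t * ∫ x, x ^ 2 ∂μ) ^ 2 := by
  rw [iteratedDeriv_four_exp (f := fun j l => t * compensatedExponent μ j l)
      fun j l => (hasDerivAt_compensatedExponent hsq hr j l).const_mul t,
    compensatedExponent_at_zero_of_lt_two zero_lt_two,
    compensatedExponent_at_zero_of_lt_two one_lt_two,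
    compensatedExponent_at_zero_of_two_le le_rfl,
    compensatedExponent_at_zero_of_two_le (by norm_num : 2 ≤ 4), mul_zero, Real.exp_zero]
  ring

theorem compensatedExponent_zero_le {μ : Measure ℝ} (hsq : Integrable (fun x : ℝ => x ^ 2) μ)
    {l : ℝ} (hl : ∀ᵐ x ∂μ, |l * x| ≤ 1) :
    compensatedExponent μ 0 l ≤ l ^ 2 * ∫ x, x ^ 2 ∂μ := by
  rw [compensatedExponent_zero, ← integral_const_mul]
  refine integral_mono_of_nonneg (Eventually.of_forall fun x => ?_) (hsq.const_mul _) ?_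
  · rw [Pi.zero_apply]
    linarith [Real.add_one_le_exp (l * x)]
  · filter_upwards [hl] with x hx
    exact (le_abs_self _).trans ((Real.abs_exp_sub_one_sub_id_le hx).trans_eq (mul_pow l x 2))

end FourthDerivative

section MomentsOfMgf

variable {Ω : Type*} [MeasurableSpace Ω] {P : Measure Ω} {Z : Ω → ℝ}

theorem integral_abs_pow_eq_iteratedDeriv_mgf
    (hint : ∀ l, Integrable (fun ω => Real.exp (l * Z ω)) P) {n : ℕ} (hn : Even n) :
    ∫ ω, |Z ω| ^ n ∂P = iteratedDeriv n (mgf Z P) 0 := by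
  have huniv : integrableExpSet Z P = Set.univ := Set.eq_univ_of_forall hint
  rw [iteratedDeriv_mgf_zero (by rw [huniv, interior_univ]; exact Set.mem_univ 0) n]
  simp only [hn.pow_abs, Pi.pow_apply]

theorem integral_rpow_abs_le {l q M : ℝ} (hl : 0 < l) (hq : 0 ≤ q)
    (hpos : Integrable (fun ω => Real.exp (l * Z ω)) P)
    (hneg : Integrable (fun ω => Real.exp (-l * Z ω)) P)
    (hM : ∀ m, |m| = l → mgf Z P m ≤ M) :
    ∫ ω, |Z ω| ^ q ∂P ≤ (q / l) ^ q * (2 * M) := by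
  calc ∫ ω, |Z ω| ^ q ∂P
      ≤ ∫ ω, (q / l) ^ q * (Real.exp (l * Z ω) + Real.exp (-l * Z ω)) ∂P := by
        refine integral_mono (integrable_rpow_abs_of_integrable_exp_mul hl.ne' hpos hneg hq)
          ((hpos.add hneg).const_mul _) fun ω => ?_
        have hmax := rpow_abs_le_mul_max_exp (Z ω) hq hl.ne'
        rw [abs_of_pos hl] at hmax
        refine hmax.trans ?_
        gcongr
        exact max_le_add_of_nonneg (Real.exp_pos _).le (Real.exp_pos _).le
    _ = (q / l) ^ q * (mgf Z P l + mgf Z P (-l)) := by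
        rw [integral_const_mul, integral_add hpos hneg]
        rfl
    _ ≤ (q / l) ^ q * (2 * M) := by
        rw [two_mul]
        gcongr
        · exact hM l (abs_of_pos hl)
        · exact hM (-l) (by rw [abs_neg, abs_of_pos hl])

end MomentsOfMgf

section Truncation

/-- The truncation `x 1_{|x| ≤ ε}`. -/
noncomputable def hardCut (ε : ℝ) : ℝ → ℝ :=
  Set.indicator {y | |y| ≤ ε} id

/-- A continuous approximation of `hardCut ε`, equal to it outside `ε < |x| < ε + 1 / (m + 1)`. -/
noncomputable def softCut (ε : ℝ) (m : ℕ) (x : ℝ) : ℝ :=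
  x * max 0 (min 1 (1 - (m + 1) * (|x| - ε)))

variable {ε : ℝ}

theorem hardCut_of_abs_le {x : ℝ} (hx : |x| ≤ ε) : hardCut ε x = x :=
  Set.indicator_of_mem (s := {y : ℝ | |y| ≤ ε}) hx id

theorem hardCut_of_lt_abs {x : ℝ} (hx : ε < |x|) : hardCut ε x = 0 :=
  Set.indicator_of_notMem (s := {y : ℝ | |y| ≤ ε}) (not_le.2 hx) id

theorem continuous_softCut (ε : ℝ) (m : ℕ) : Continuous (softCut ε m) := by
  unfold softCut
  fun_prop

theorem softCut_of_abs_le (m : ℕ) {x : ℝ} (hx : |x| ≤ ε) : softCut ε m x = x := by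
  have hnonpos : ((m : ℝ) + 1) * (|x| - ε) ≤ 0 :=
    mul_nonpos_of_nonneg_of_nonpos (by positivity) (by linarith)
  rw [softCut, min_eq_left (by linarith), max_eq_right zero_le_one, mul_one]

theorem softCut_eq_zero {m : ℕ} {x : ℝ} (hx : 1 ≤ (m + 1) * (|x| - ε)) : softCut ε m x = 0 := by
  rw [softCut, max_eq_left ((min_le_right _ _).trans (by linarith)), mul_zero]

theorem abs_softCut_le (hε : 0 ≤ ε) (m : ℕ) (x : ℝ) : |softCut ε m x| ≤ ε + 1 := by
  rcases le_or_gt |x| (ε + 1) with h | h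
  · rw [softCut, abs_mul, abs_of_nonneg (a := max 0 _) (le_max_left _ _)]
    exact (mul_le_of_le_one_right (abs_nonneg x) (max_le zero_le_one (min_le_left _ _))).trans h
  · rw [softCut_eq_zero (by nlinarith [m.cast_nonneg (α := ℝ)]), abs_zero]
    positivity

theorem eventually_softCut_eq_hardCut (ε x : ℝ) :
    ∀ᶠ m in atTop, softCut ε m x = hardCut ε x := by
  rcases le_or_gt |x| ε with hx | hx
  · exact Eventually.of_forall fun m => by rw [softCut_of_abs_le m hx, hardCut_of_abs_le hx]
  · have hx' : 0 < |x| - ε := sub_pos.2 hx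
    filter_upwards [eventually_ge_atTop ⌈1 / (|x| - ε)⌉₊] with m hm
    rw [hardCut_of_lt_abs hx, softCut_eq_zero]
    rw [← div_le_iff₀ hx']
    exact (Nat.ceil_le.1 hm).trans (le_add_of_nonneg_right zero_le_one)

theorem IsCadlag.tendsto_largeJumpSum_sub_softCut {x : ℝ≥0 → ℝ} (hx : IsCadlag x) (t : ℝ≥0)
    (hε : 0 < ε) :
    Tendsto (fun m => largeJumpSum (fun y => y - softCut ε m y) x ε t) atTop
      (𝓝 (largeJumpSum id x ε t)) := by
  have hfin := hx.finite_largeJumpTimes t hε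
  simp only [largeJumpSum, finsum_mem_eq_finite_toFinset_sum _ hfin]
  refine tendsto_finsetSum _ fun s hs => tendsto_const_nhds.congr' ?_
  have hjump : ε < |jump x s| := ((Set.Finite.mem_toFinset hfin).1 hs).2
  filter_upwards [eventually_softCut_eq_hardCut ε (jump x s)] with m hm
  rw [hm, hardCut_of_lt_abs hjump, sub_zero, id_eq]

end Truncation

section TruncatedExponent

variable {ν : Measure ℝ} {ε : ℝ}

theorem sq_le_min_one_sq (hε : 0 ≤ ε) (hε1 : ε ≤ 1) {x : ℝ} (hx : ε ≤ |x|) :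
    ε ^ 2 ≤ min 1 (x ^ 2) :=
  le_min (pow_le_one₀ hε hε1) ((pow_le_pow_left₀ hε hx 2).trans_eq (sq_abs x))

theorem abs_indicator_abs_le_one (x : ℝ) : |Set.indicator {y : ℝ | |y| ≤ 1} id x| ≤ 1 := by
  by_cases hx : |x| ≤ 1
  · exact (congrArg abs (hardCut_of_abs_le hx)).trans_le hx
  · exact (congrArg abs (hardCut_of_lt_abs (not_le.1 hx))).trans_le (abs_zero.trans_le zero_le_one)

theorem abs_exp_mul_sub_indicator_le {g : ℝ → ℝ} {C : ℝ} (hε : 0 < ε) (hε1 : ε ≤ 1)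
    (hgε : ∀ x, |x| ≤ ε → g x = x) (hC : ∀ x, |g x| ≤ C) (l x : ℝ) :
    |Real.exp (l * g x) - 1 - l * Set.indicator {y : ℝ | |y| ≤ 1} id x| ≤
      (l ^ 2 * Real.exp |l| + (Real.exp (|l| * C) + 1 + |l|) / ε ^ 2) * min 1 (x ^ 2) := by
  have := min_one_sq_nonneg x
  rw [add_mul]
  rcases le_or_gt |x| ε with hx | hx
  · have hx1 : |x| ≤ 1 := hx.trans hε1
    have hsq : min 1 (x ^ 2) = x ^ 2 := min_eq_right ((sq_le_one_iff_abs_le_one x).2 hx1)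
    rw [Set.indicator_of_mem (show x ∈ {y : ℝ | |y| ≤ 1} from hx1), hgε x hx, id_eq,
      ← expTail_two, hsq]
    refine le_add_of_le_of_nonneg ((abs_expTail_le 2 (l * x)).trans ?_) (by positivity)
    rw [sq_abs, mul_pow, mul_right_comm]
    have hlx : |l * x| ≤ |l| := (abs_mul l x).trans_le (mul_le_of_le_one_right (abs_nonneg l) hx1)
    gcongr
  · refine le_add_of_nonneg_of_le (by positivity) ?_
    calc |Real.exp (l * g x) - 1 - l * Set.indicator {y : ℝ | |y| ≤ 1} id x|
        ≤ Real.exp (|l| * C) + 1 + |l| := by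
          refine (abs_sub _ _).trans (add_le_add ((abs_sub _ _).trans ?_) ?_)
          · rw [Real.abs_exp, abs_one]
            exact add_le_add_left (exp_mul_le_exp_abs_mul l (hC x)) 1
          · rw [abs_mul]
            exact mul_le_of_le_one_right (abs_nonneg l) (abs_indicator_abs_le_one x)
      _ = (Real.exp (|l| * C) + 1 + |l|) / ε ^ 2 * ε ^ 2 := by field_simp
      _ ≤ (Real.exp (|l| * C) + 1 + |l|) / ε ^ 2 * min 1 (x ^ 2) := by
          gcongr
          exact sq_le_min_one_sq hε.le hε1 hx.le

theorem measurable_exp_mul_sub_indicator {g : ℝ → ℝ} (hg : Measurable g) (l : ℝ) :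
    Measurable fun x => Real.exp (l * g x) - 1 - l * Set.indicator {y : ℝ | |y| ≤ 1} id x :=
  ((hg.const_mul l).exp.sub_const 1).sub
    ((measurable_id.indicator (measurableSet_abs_le 1)).const_mul l)

theorem ae_restrict_abs_le (ν : Measure ℝ) (ε : ℝ) :
    ∀ᵐ x ∂ν.restrict {x | |x| ≤ ε}, |x| ≤ ε :=
  ae_restrict_mem (measurableSet_abs_le ε)

theorem measurableSet_annulus (ε : ℝ) : MeasurableSet {x : ℝ | ε < |x| ∧ |x| ≤ 1} :=
  (measurableSet_lt measurable_const continuous_abs.measurable).inter (measurableSet_abs_le 1)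

variable (hν : Integrable (fun x : ℝ => min 1 (x ^ 2)) ν)

include hν

theorem tendsto_laplaceExponent (γ b : ℝ) (hε : 0 < ε) (hε1 : ε ≤ 1) {g : ℕ → ℝ → ℝ}
    {g' : ℝ → ℝ} {C : ℝ} (hg : ∀ m, Measurable (g m)) (hgε : ∀ m x, |x| ≤ ε → g m x = x)
    (hC : ∀ m x, |g m x| ≤ C) (hlim : ∀ x, Tendsto (fun m => g m x) atTop (𝓝 (g' x))) (l : ℝ) :
    Tendsto (fun m => laplaceExponent γ b ν (g m) l) atTop (𝓝 (laplaceExponent γ b ν g' l)) := by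
  refine Tendsto.const_add _ (tendsto_integral_of_dominated_convergence _
    (fun m => (measurable_exp_mul_sub_indicator (hg m) l).aestronglyMeasurable)
    (hν.const_mul (l ^ 2 * Real.exp |l| + (Real.exp (|l| * C) + 1 + |l|) / ε ^ 2))
    (fun m => Eventually.of_forall (abs_exp_mul_sub_indicator_le hε hε1 (hgε m) (hC m) l))
    (Eventually.of_forall fun x => ?_))
  exact (((Real.continuous_exp.tendsto _).comp ((hlim x).const_mul l)).sub_const 1).sub_const _

theorem integrable_sq_restrict_abs_le (hε1 : ε ≤ 1) :
    Integrable (fun x : ℝ => x ^ 2) (ν.restrict {x | |x| ≤ ε}) := by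
  refine IntegrableOn.congr_fun hν.integrableOn (fun x hx => ?_) (measurableSet_abs_le ε)
  exact min_eq_right ((sq_le_one_iff_abs_le_one x).2 (le_trans hx hε1))

theorem integrableOn_annulus (hε : 0 < ε) (hε1 : ε ≤ 1) :
    IntegrableOn (fun x : ℝ => x) {x : ℝ | ε < |x| ∧ |x| ≤ 1} ν := by
  refine ((hν.const_mul (1 / ε ^ 2)).integrableOn).mono' (by fun_prop) ?_
  filter_upwards [ae_restrict_mem (measurableSet_annulus ε)] with x hx
  calc ‖x‖ ≤ 1 := hx.2
    _ = 1 / ε ^ 2 * ε ^ 2 := by field_simp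
    _ ≤ 1 / ε ^ 2 * min 1 (x ^ 2) := by
      gcongr
      exact sq_le_min_one_sq hε.le hε1 hx.1.le

theorem laplaceExponent_hardCut (γ b : ℝ) (hε : 0 < ε) (hε1 : ε ≤ 1) (l : ℝ) :
    laplaceExponent γ b ν (hardCut ε) l =
      l * γ + b ^ 2 * l ^ 2 / 2 + compensatedExponent (ν.restrict {x | |x| ≤ ε}) 0 l
        - l * ∫ x in {x : ℝ | ε < |x| ∧ |x| ≤ 1}, x ∂ν := by
  have hsmall : Integrable (fun x : ℝ => Real.exp (l * x) - 1 - l * x)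
      (ν.restrict {x | |x| ≤ ε}) := by
    simpa only [pow_zero, one_mul, Nat.sub_zero, expTail_two] using
      integrable_pow_mul_expTail (integrable_sq_restrict_abs_le hν hε1) (ae_restrict_abs_le ν ε) 0 l
  have hmid : IntegrableOn (fun x : ℝ => l * x) {x : ℝ | ε < |x| ∧ |x| ≤ 1} ν :=
    (integrableOn_annulus hν hε hε1).const_mul l
  rw [laplaceExponent, compensatedExponent_zero, add_sub_assoc, ← integral_const_mul,
    ← integral_indicator (measurableSet_abs_le ε), ← integral_indicator (measurableSet_annulus ε),
    ← integral_sub (IntegrableOn.integrable_indicator hsmall (measurableSet_abs_le ε))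
      (hmid.integrable_indicator (measurableSet_annulus ε))]
  refine congrArg _ (integral_congr_ae (Eventually.of_forall fun x => ?_))
  rcases le_or_gt |x| ε with hx | hx
  · simp [hardCut_of_abs_le hx, hx, hx.trans hε1, not_lt.2 hx]
  · by_cases hx1 : |x| ≤ 1 <;> simp [hardCut_of_lt_abs hx, hx, hx1, not_le.2 hx]

end TruncatedExponent

section PathFunctional

variable {ε : ℝ}

/-- A functional on paths, measurable for the product `σ`-algebra, that computes the sum of the
large jumps of a càdlàg path from countably many of its increments. -/
noncomputable def gridJumpSum (ε : ℝ) (t : ℝ≥0) (x : ℝ≥0 → ℝ) : ℝ :=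
  limsup (fun m => limsup (gridSum (fun y => y - softCut ε m y) x t) atTop) atTop

theorem measurable_gridJumpSum (ε : ℝ) (t : ℝ≥0) : Measurable (gridJumpSum ε t) := by
  refine Measurable.limsup fun m => Measurable.limsup fun n =>
    Finset.measurable_fun_sum _ fun k _ => ?_
  have hincrement : Measurable fun x : ℝ≥0 → ℝ => gridIncrement x t n k :=
    (measurable_pi_apply _).sub (measurable_pi_apply _)
  exact hincrement.sub ((continuous_softCut ε m).measurable.comp hincrement)

theorem IsCadlag.gridJumpSum_eq {x : ℝ≥0 → ℝ} (hx : IsCadlag x) (t : ℝ≥0) (hε : 0 < ε) :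
    gridJumpSum ε t x = largeJumpSum id x ε t := by
  have hgrid (m : ℕ) : limsup (gridSum (fun y => y - softCut ε m y) x t) atTop =
      largeJumpSum (fun y => y - softCut ε m y) x ε t :=
    (hx.tendsto_gridSum (f := fun y => y - softCut ε m y) t hε
      (continuous_id.sub (continuous_softCut ε m)) fun y hy => by
        rw [softCut_of_abs_le m hy, sub_self]).limsup_eq
  simp only [gridJumpSum, hgrid]
  exact (hx.tendsto_largeJumpSum_sub_softCut t hε).limsup_eq

theorem IsCadlag.sub_continuous {x y : ℝ≥0 → ℝ} (hx : IsCadlag x) (hy : Continuous y) :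
    IsCadlag (fun s => x s - y s) := fun t =>
  ⟨(hx t).1.sub hy.continuousWithinAt, by
    obtain ⟨l, hl⟩ := (hx t).2
    exact ⟨l - y t, hl.sub ((hy.tendsto t).mono_left nhdsWithin_le_nhds)⟩⟩

theorem IsCadlag.jump_sub_continuous {x y : ℝ≥0 → ℝ} (hx : IsCadlag x) (hy : Continuous y)
    (s : ℝ≥0) : jump (fun r => x r - y r) s = jump x s := by
  rcases eq_or_neBot (𝓝[<] s) with h | h
  · rw [jump_eq_zero_of_eq_bot h, jump_eq_zero_of_eq_bot h]
  · have hleft := tendsto_nhds_unique ((hx.sub_continuous hy).tendsto_leftLim s)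
      ((hx.tendsto_leftLim s).sub ((hy.tendsto s).mono_left nhdsWithin_le_nhds))
    rw [jump, jump, hleft]
    ring

theorem IsCadlag.largeJumpSum_sub_continuous {x y : ℝ≥0 → ℝ} (hx : IsCadlag x)
    (hy : Continuous y) (f : ℝ → ℝ) (ε : ℝ) (t : ℝ≥0) :
    largeJumpSum f (fun s => x s - y s) ε t = largeJumpSum f x ε t := by
  simp only [largeJumpSum, largeJumpTimes, hx.jump_sub_continuous hy]

end PathFunctional

section Sigma

variable {ν : Measure ℝ} {ε : ℝ}

theorem sigma_sq (ν : Measure ℝ) (ε : ℝ) :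
    sigma ν ε ^ 2 = ∫ x in {x : ℝ | |x| ≤ ε}, x ^ 2 ∂ν :=
  Real.sq_sqrt (integral_nonneg fun x => sq_nonneg x)

theorem sigma0_pos (ν : Measure ℝ) (hε : 0 < ε) : 0 < sigma0 ν ε :=
  lt_max_of_lt_right hε

theorem IsLevyMeasure.compensatedExponent_le_one (hν : IsLevyMeasure ν) (hε : 0 < ε)
    (hε1 : ε ≤ 1) {l : ℝ} (hl : |l| = (sigma0 ν ε)⁻¹) :
    compensatedExponent (ν.restrict {x | |x| ≤ ε}) 0 l ≤ 1 := by
  have h0 := sigma0_pos ν hε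
  have hsmall : ∀ᵐ x ∂ν.restrict {x | |x| ≤ ε}, |l * x| ≤ 1 := by
    filter_upwards [ae_restrict_abs_le ν ε] with x hx
    rw [abs_mul, hl, inv_mul_le_one₀ h0]
    exact hx.trans (le_max_right _ _)
  calc compensatedExponent (ν.restrict {x | |x| ≤ ε}) 0 l
      ≤ l ^ 2 * ∫ x in {x : ℝ | |x| ≤ ε}, x ^ 2 ∂ν :=
        compensatedExponent_zero_le (integrable_sq_restrict_abs_le hν.integrable hε1) hsmall
    _ = (sigma ν ε / sigma0 ν ε) ^ 2 := by
        rw [← sigma_sq, ← sq_abs l, hl]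
        field_simp
    _ ≤ 1 := pow_le_one₀ (div_nonneg (Real.sqrt_nonneg _) h0.le)
        ((div_le_one h0).2 (le_max_left _ _))

end Sigma

section Remainder

variable {Ω : Type*} {X B : ℝ≥0 → Ω → ℝ} {γ b : ℝ} {ν : Measure ℝ} {ε : ℝ}

theorem remainder_eq (X B : ℝ≥0 → Ω → ℝ) (γ b : ℝ) (ν : Measure ℝ) (ε : ℝ) (t : ℝ≥0) (ω : Ω) :
    remainder X γ b B ν ε t ω = X t ω - b * B t ω - largeJumpSum id (fun s => X s ω) ε t +
      t * ((∫ x in {x : ℝ | ε < |x| ∧ |x| ≤ 1}, x ∂ν) - γ) := by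
  simp only [remainder, truncated, largeJumpSum, largeJumpTimes, id_eq]
  ring

variable [MeasurableSpace Ω] {P : Measure Ω}

theorem IsLevyProcess.aemeasurable_remainder (hX : IsLevyProcess P X) {t : ℝ≥0}
    (hB : AEMeasurable (B t) P) (hε : 0 < ε) : AEMeasurable (remainder X γ b B ν ε t) P := by
  have hjumps : AEMeasurable (fun ω => largeJumpSum id (fun s => X s ω) ε t) P := by
    refine ((measurable_gridJumpSum ε t).comp (measurable_pi_lambda _ hX.measurable)).aemeasurable
      |>.congr ?_
    filter_upwards [hX.cadlag] with ω hω using hω.gridJumpSum_eq t hε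
  rw [funext (remainder_eq X B γ b ν ε t)]
  exact ((((hX.measurable t).aemeasurable.sub (hB.const_mul b)).sub hjumps).add_const _)

theorem IsLevyProcess.indepFun_remainder (hX : IsLevyProcess P X) (hBr : IsBrownianReal B P)
    (hind : IndepFun (fun ω s => B s ω) (fun ω s => X s ω - b * B s ω) P) (t : ℝ≥0)
    (hε : 0 < ε) : IndepFun (remainder X γ b B ν ε t) (fun ω => b * B t ω) P := by
  have hfunctional := hind.symm.comp
    (φ := fun x : ℝ≥0 → ℝ => x t - gridJumpSum ε t x +
      t * ((∫ x in {x : ℝ | ε < |x| ∧ |x| ≤ 1}, x ∂ν) - γ))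
    (ψ := fun x : ℝ≥0 → ℝ => b * x t)
    (((measurable_pi_apply t).sub (measurable_gridJumpSum ε t)).add_const _) (by fun_prop)
  refine hfunctional.congr ?_ EventuallyEq.rfl
  filter_upwards [hX.cadlag, hBr.cont] with ω hXω hBω
  have hcont : Continuous fun s => b * B s ω := continuous_const.mul hBω
  rw [remainder_eq, Function.comp_apply, (hXω.sub_continuous hcont).gridJumpSum_eq t hε,
    hXω.largeJumpSum_sub_continuous hcont]

variable [IsProbabilityMeasure P]

theorem IsLevyProcess.mgf_sub_largeJumpSum_id (hX : IsLevyProcess P X)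
    (hT : HasTriplet P X γ b ν) (t : ℝ≥0) (hε : 0 < ε) (hε1 : ε ≤ 1) (l : ℝ) :
    mgf (fun ω => X t ω - largeJumpSum id (fun s => X s ω) ε t) P l =
      Real.exp (t * laplaceExponent γ b ν (hardCut ε) l) := by
  have hsoft (m : ℕ) (l : ℝ) := hX.mgf_sub_largeJumpSum hT t (continuous_softCut ε m) hε
    (fun _ hx => softCut_of_abs_le m hx) (abs_softCut_le hε.le m) l
  have hlim : ∀ᵐ ω ∂P, Tendsto
      (fun m => X t ω - largeJumpSum (fun y => y - softCut ε m y) (fun s => X s ω) ε t) atTop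
      (𝓝 (X t ω - largeJumpSum id (fun s => X s ω) ε t)) := by
    filter_upwards [hX.cadlag] with ω hω
    exact (hω.tendsto_largeJumpSum_sub_softCut t hε).const_sub _
  refine (mgf_eq_of_tendsto (fun m l => (hsoft m l).1) hlim
    (M := fun l => Real.exp (t * laplaceExponent γ b ν (hardCut ε) l)) (fun l => ?_) l).2
  simp only [fun m => (hsoft m l).2]
  exact (Real.continuous_exp.tendsto _).comp ((tendsto_laplaceExponent hT.levyMeasure.integrable
    γ b hε hε1 (fun m => (continuous_softCut ε m).measurable) (fun m _ => softCut_of_abs_le m)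
    (abs_softCut_le hε.le) (fun x => tendsto_const_nhds.congr'
      ((eventually_softCut_eq_hardCut ε x).mono fun _ => Eq.symm)) l).const_mul _)

theorem IsLevyProcess.mgf_remainder_add (hX : IsLevyProcess P X) (hT : HasTriplet P X γ b ν)
    (B : ℝ≥0 → Ω → ℝ) (t : ℝ≥0) (hε : 0 < ε) (hε1 : ε ≤ 1) (l : ℝ) :
    mgf (fun ω => remainder X γ b B ν ε t ω + b * B t ω) P l =
      Real.exp (t * compensatedExponent (ν.restrict {x | |x| ≤ ε}) 0 l) *
        Real.exp (t * (b * l) ^ 2 / 2) := by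
  have hshift (ω : Ω) : remainder X γ b B ν ε t ω + b * B t ω =
      (X t ω - largeJumpSum id (fun s => X s ω) ε t) +
        t * ((∫ x in {x : ℝ | ε < |x| ∧ |x| ≤ 1}, x ∂ν) - γ) := by
    rw [remainder_eq]
    ring
  simp only [hshift]
  rw [mgf_add_const, hX.mgf_sub_largeJumpSum_id hT t hε hε1,
    laplaceExponent_hardCut hT.levyMeasure.integrable γ b hε hε1, ← Real.exp_add, ← Real.exp_add]
  ring_nf

theorem mgf_remainder (hX : IsLevyProcess P X) (hT : HasTriplet P X γ b ν)
    (hB : IsBrownianComponent P X b B) (t : ℝ≥0) (hε : 0 < ε) (hε1 : ε ≤ 1) (l : ℝ) :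
    mgf (remainder X γ b B ν ε t) P l =
      Real.exp (t * compensatedExponent (ν.restrict {x | |x| ≤ ε}) 0 l) := by
  have hsum := hX.mgf_remainder_add hT B t hε hε1 l
  rcases eq_or_ne b 0 with rfl | hb
  · simpa only [zero_mul, add_zero, zero_pow two_ne_zero, mul_zero, zero_div, Real.exp_zero,
      mul_one] using hsum
  · obtain ⟨hBr, hind⟩ := hB hb
    have hBt : AEMeasurable (B t) P := hBr.aemeasurable t
    have hR : AEMeasurable (remainder X γ b B ν ε t) P := hX.aemeasurable_remainder hBt hε
    have hRB : IndepFun (remainder X γ b B ν ε t) (fun ω => b * B t ω) P :=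
      hX.indepFun_remainder hBr hind t hε
    have hprod := hRB.mgf_add' (t := l) hR.aestronglyMeasurable
      (hBt.const_mul b).aestronglyMeasurable
    rw [mgf_const_mul, mgf_gaussianReal (hBr.hasLaw_eval t).map_eq, zero_mul, zero_add] at hprod
    exact mul_right_cancel₀ (Real.exp_pos _).ne' (hprod.symm.trans hsum)

theorem integrable_exp_mul_remainder (hX : IsLevyProcess P X) (hT : HasTriplet P X γ b ν)
    (hB : IsBrownianComponent P X b B) (t : ℝ≥0) (hε : 0 < ε) (hε1 : ε ≤ 1) (l : ℝ) :
    Integrable (fun ω => Real.exp (l * remainder X γ b B ν ε t ω)) P :=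
  mgf_pos_iff.1 <| (mgf_remainder hX hT hB t hε hε1 l).symm ▸ Real.exp_pos _

theorem integral_abs_remainder_pow_four (hX : IsLevyProcess P X) (hT : HasTriplet P X γ b ν)
    (hB : IsBrownianComponent P X b B) (t : ℝ≥0) (hε : 0 < ε) (hε1 : ε ≤ 1) :
    ∫ ω, |remainder X γ b B ν ε t ω| ^ 4 ∂P =
      t * (∫ x in {x : ℝ | |x| ≤ ε}, x ^ 4 ∂ν) + 3 * (t * sigma ν ε ^ 2) ^ 2 := by
  rw [integral_abs_pow_eq_iteratedDeriv_mgf (integrable_exp_mul_remainder hX hT hB t hε hε1)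
      (by decide), funext (mgf_remainder hX hT hB t hε hε1),
    iteratedDeriv_four_exp_compensatedExponent
      (integrable_sq_restrict_abs_le hT.levyMeasure.integrable hε1) (ae_restrict_abs_le ν ε),
    sigma_sq]

theorem integral_abs_remainder_rpow_le (hX : IsLevyProcess P X) (hT : HasTriplet P X γ b ν)
    (hB : IsBrownianComponent P X b B) (t : ℝ≥0) (hε : 0 < ε) (hε1 : ε ≤ 1) {q : ℝ}
    (hq : 0 ≤ q) :
    ∫ ω, |remainder X γ b B ν ε t ω| ^ q ∂P ≤ q ^ q * (2 * Real.exp t) * sigma0 ν ε ^ q := by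
  have hσ := sigma0_pos ν hε
  have hint := integrable_exp_mul_remainder hX hT hB t hε hε1
  have hmgf (m : ℝ) (hm : |m| = (sigma0 ν ε)⁻¹) :
      mgf (remainder X γ b B ν ε t) P m ≤ Real.exp t := by
    rw [mgf_remainder hX hT hB t hε hε1, Real.exp_le_exp]
    exact mul_le_of_le_one_right t.coe_nonneg
      (hT.levyMeasure.compensatedExponent_le_one hε hε1 hm)
  calc ∫ ω, |remainder X γ b B ν ε t ω| ^ q ∂P
      ≤ (q / (sigma0 ν ε)⁻¹) ^ q * (2 * Real.exp t) :=
        integral_rpow_abs_le (inv_pos.2 hσ) hq (hint _) (hint _) hmgf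
    _ = q ^ q * (2 * Real.exp t) * sigma0 ν ε ^ q := by
        rw [div_inv_eq_mul, Real.mul_rpow hq hσ.le, mul_right_comm]

end Remainder

end SmallJumps

theorem proposition1 :
    (∀ (Ω : Type u) [MeasurableSpace Ω] (P : Measure Ω) [IsProbabilityMeasure P]
      (X B : ℝ≥0 → Ω → ℝ) (γ b : ℝ) (ν : Measure ℝ) (ε : ℝ) (t : ℝ≥0),
      0 ≤ b → SmallJumps.IsLevyProcess P X → SmallJumps.HasTriplet P X γ b ν →
      SmallJumps.IsBrownianComponent P X b B → 0 < ε → ε ≤ 1 →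
      Integrable (fun ω => |SmallJumps.remainder X γ b B ν ε t ω| ^ 4) P ∧
      ∫ ω, |SmallJumps.remainder X γ b B ν ε t ω| ^ 4 ∂P =
        t * (∫ x in {x : ℝ | |x| ≤ ε}, x ^ 4 ∂ν) + 3 * (t * SmallJumps.sigma ν ε ^ 2) ^ 2) ∧
    (∀ (q : ℝ) (t : ℝ≥0), 0 < q → ∃ K : ℝ, 0 < K ∧
      ∀ (Ω : Type u) [MeasurableSpace Ω] (P : Measure Ω) [IsProbabilityMeasure P]
        (X B : ℝ≥0 → Ω → ℝ) (γ b : ℝ) (ν : Measure ℝ) (ε : ℝ),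
        0 ≤ b → SmallJumps.IsLevyProcess P X → SmallJumps.HasTriplet P X γ b ν →
        SmallJumps.IsBrownianComponent P X b B → 0 < ε → ε ≤ 1 →
        Integrable (fun ω => |SmallJumps.remainder X γ b B ν ε t ω| ^ q) P ∧
        ∫ ω, |SmallJumps.remainder X γ b B ν ε t ω| ^ q ∂P ≤ K * SmallJumps.sigma0 ν ε ^ q) := by
  refine ⟨fun Ω _ P _ X B γ b ν ε t _ hX hT hB hε hε1 => ⟨?_, ?_⟩, fun q t hq =>
    ⟨q ^ q * (2 * Real.exp t), by positivity, fun Ω _ P _ X B γ b ν ε _ hX hT hB hε hε1 =>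
      ⟨?_, ?_⟩⟩⟩
  · have hint := SmallJumps.integrable_exp_mul_remainder hX hT hB t hε hε1
    exact integrable_pow_abs_of_integrable_exp_mul one_ne_zero (hint 1) (hint (-1)) 4
  · exact SmallJumps.integral_abs_remainder_pow_four hX hT hB t hε hε1
  · have hint := SmallJumps.integrable_exp_mul_remainder hX hT hB t hε hε1
    exact integrable_rpow_abs_of_integrable_exp_mul one_ne_zero (hint 1) (hint (-1)) hq.le
  · exact SmallJumps.integral_abs_remainder_rpow_le hX hT hB t hε hε1 hq.le
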